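/- **Setting.** Let $\mathcal X\subset\mathbb R^d$ be open and let $dx$ be Lebesgue measure on it. Let $\Theta\subset\mathbb R$, let $\theta_0$ be an interior point of $\Theta$, and let $\mathcal P=(P_\theta)_{\theta\in\Theta}$ be a family of probability measures on $\mathcal X$ with densities $p_\theta=dP_\theta/dx$. A model with densities $p_\theta$ with respect to a dominating measure $\nu$ is differentiable in quadratic mean (DQM) at $\theta_0$ with score $s_{\theta_0}$ if $s_{\theta_0}$ is measurable and $\int\big(\sqrt{p_{\theta_0+h}}-\sqrt{p_{\theta_0}}-\tfrac12 h\,s_{\theta_0}\sqrt{p_{\theta_0}}\big)^2d\nu=o(h^2)$ as $h\to0$; its Fisher information is then $\mathcal I_{\theta_0}=\mathbb E_{\theta_0}[s_{\theta_0}^2]$. Assume that $\mathcal P$ is DQM at $\theta_0$ with respect to $dx$, with score $s_{\theta_0}$. Let $\alpha>0$. Let $B$ be the set of (a.e. classes of) measurable $v:\mathcal X\to\mathbb R$ with $1\le v\le e^\alpha$ a.e., with the weak-$\star$ topology of $L^\infty=(L^1)^*$ and its Borel $\sigma$-algebra, and let $\mathcal E\subset B$ be the set of those $r$ with $r(x)\in\{1,e^\alpha\}$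 for a.e. $x$. For $r\in\mathcal E$ put $F_r^+=\{x: r(x)=e^\alpha\}$. Let $(x,r)\mapsto e_x(r)$ be a jointly measurable evaluation map with, for each $r\in B$, $e_x(r)=r(x)$ for a.e. $x$; concretely, $e_x(r)=\limsup_{n\to\infty}$ of the averages of $r$ over $\{y\in\mathcal X:|y-x|\le 1/n\}$. For $r\in B$ let $T(r)=e^\alpha+1-r$ and $$i(r)=\frac{\left(\int_{\mathcal X}s_{\theta_0}(x)r(x)p_{\theta_0}(x)\,dx\right)^2}{\int_{\mathcal X}r(x)p_{\theta_0}(x)\,dx},\qquad i^{(s)}(r)=\tfrac12\left[i(r)+i(T(r))\right].$$ A Radon sub-probability measure $\mu$ on $\mathcal E$ is called normalized if $\int_{\mathcal E}e_x(r)\,\mu(dr)=1$ for a.e. $x\in\mathcal X$; it defines the mechanism $q^{(\mu)}(x,dr)=e_x(r)\,\mu(dr)$. Let $I^*$ be the supremum of $\int_{\mathcal E}i(r)\,\mu(dr)$ over all normalized Radon sub-probability measures $\mu$ on $\mathcal E$. Let $\mathcal J^{\max,\alpha}_{\theta_0}$ be the maximal Fisher information at $\theta_0$ of the privatized models $Q\circ\mathcal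 P=(Q\circ P_\theta)_{\theta\in\Theta}$, where $Q$ runs through all Markov kernels from $\mathcal X$ to a Polish space that satisfy $Q(A\mid x)\le e^\alpha Q(A\mid x')$ for all $x,x'\in\mathcal X$ and all measurable $A$. **Theorem.** Suppose that $\bar\mu$ is a normalized Radon sub-probability measure on $\mathcal E$ that attains $I^*$ and is symmetric, i.e. invariant under $T$. Then: 1. The function $r\mapsto i^{(s)}(r)$ is $\bar\mu$-almost everywhere constant. 2. The maximum of $i^{(s)}$ over $B$ exists, the maximum $\mathcal J^{\max,\alpha}_{\theta_0}$ exists, and $$\mathcal J^{\max,\alpha}_{\theta_0}=\mathcal I_{\theta_0}\big(q^{(\bar\mu)}\circ\mathcal P\big)=I^*=\frac{2}{e^\alpha+1}\,\max_{r\in B}i^{(s)}(r).$$ 3. For every $r\in\mathcal E$, $$i^{(s)}(r)=\frac{(e^\alpha-1)^2(e^\alpha+1)}{2}\cdot\frac{\left(\int_{F_r^+}s_{\theta_0}(x)p_{\theta_0}(x)\,dx\right)^2}{\left(e^\alpha-(e^\alpha-1)\int_{F_r^+}p_{\theta_0}(x)\,dx\right)\left(1+(e^\alpha-1)\int_{F_r^+}p_{\theta_0}(x)\,dx\right)}.$$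 -/

import Mathlib

open MeasureTheory ProbabilityTheory Filter Topology

noncomputable section

/-! ### Statistical models, differentiability in quadratic mean, Fisher information -/

/-- The (real-valued) density `dP/dν`. -/
def modelDensity {Y : Type} [MeasurableSpace Y] (ν P : Measure Y) (y : Y) : ℝ :=
  (P.rnDeriv ν y).toReal

/-- The one-parameter model `P`, dominated by `ν`, is differentiable in quadratic mean at `θ₀`
with score `s`: with `p_θ = dP_θ/dν`,
`∫ (√p_{θ₀+h} - √p_{θ₀} - (1/2) h s √p_{θ₀})² dν = o(h²)` as `h → 0`. -/
def IsDQMScore {Y : Type} [MeasurableSpace Y] (ν : Measure Y) (P : ℝ → Measure Y) (θ₀ : ℝ)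
    (s : Y → ℝ) : Prop :=
  Measurable s ∧
    Tendsto
      (fun h : ℝ =>
        (∫⁻ y, ENNReal.ofReal
          ((√(modelDensity ν (P (θ₀ + h)) y) - √(modelDensity ν (P θ₀) y)
            - (1 / 2) * h * s y * √(modelDensity ν (P θ₀) y)) ^ 2) ∂ν) / ENNReal.ofReal (h ^ 2))
      (𝓝[≠] 0) (𝓝 0)

/-- The model `(P_θ)_{θ ∈ Θ}` is dominated and differentiable in quadratic mean at `θ₀`, and its
Fisher information `E_{θ₀}[t²]`, with `t` the score at `θ₀`, is `I`. -/
def HasFisherInfo {Y : Type} [MeasurableSpace Y] (Θ : Set ℝ) (P : ℝ → Measure Y) (θ₀ I : ℝ) :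
    Prop :=
  ∃ ν : Measure Y, SigmaFinite ν ∧ (∀ θ ∈ Θ, P θ ≪ ν) ∧
    ∃ t : Y → ℝ, IsDQMScore ν P θ₀ t ∧ I = ∫ y, t y ^ 2 ∂(P θ₀)

/-! ### Local differential privacy -/

/-- `Q(A | x) ≤ e^α Q(A | x')` for all `x`, `x'` and all measurable `A`. -/
def IsLDP {𝒳 Z : Type} [MeasurableSpace 𝒳] [MeasurableSpace Z] (α : ℝ) (Q : Kernel 𝒳 Z) : Prop :=
  ∀ x x' : 𝒳, ∀ A : Set Z, MeasurableSet A → Q x A ≤ ENNReal.ofReal (Real.exp α) * Q x' A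

/-- The Fisher informations at `θ₀` of the privatized models `(Q ∘ P_θ)_{θ ∈ Θ}`, where `Q` runs
through all `α`-locally differentially private Markov kernels from the data space to a Polish
space. Its maximum is the maximal Fisher information under `α`-LDP. -/
def privateFisherInfos {𝒳 : Type} [MeasurableSpace 𝒳] (α : ℝ) (Θ : Set ℝ) (P : ℝ → Measure 𝒳)
    (θ₀ : ℝ) : Set ℝ :=
  {I | ∃ (Z : Type) (_ : TopologicalSpace Z) (_ : PolishSpace Z) (_ : MeasurableSpace Z)
      (_ : BorelSpace Z) (Q : Kernel 𝒳 Z) (_ : IsMarkovKernel Q),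
      IsLDP α Q ∧ HasFisherInfo Θ (fun θ => (P θ).bind Q) θ₀ I}

/-! ### The sets `B` and `𝓔` -/

/-- The set `B` of (a.e. classes of) measurable functions `v` with `1 ≤ v ≤ e^α` a.e. -/
structure StairBox {𝒳 : Type} [MeasurableSpace 𝒳] (lam : Measure 𝒳) (α : ℝ) where
  toFun : 𝒳 →ₘ[lam] ℝ
  bounds : ∀ᵐ x ∂lam, 1 ≤ toFun x ∧ toFun x ≤ Real.exp α

/-- The weak-star topology of `L^∞ = (L¹)*` on `B`. -/
instance StairBox.instTopologicalSpace {𝒳 : Type} [MeasurableSpace 𝒳] (lam : Measure 𝒳) (α : ℝ) :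
    TopologicalSpace (StairBox lam α) :=
  ⨅ f : Lp ℝ 1 lam,
    TopologicalSpace.induced (fun v : StairBox lam α => ∫ x, f x * v.toFun x ∂lam) inferInstance

instance StairBox.instMeasurableSpace {𝒳 : Type} [MeasurableSpace 𝒳] (lam : Measure 𝒳) (α : ℝ) :
    MeasurableSpace (StairBox lam α) :=
  borel (StairBox lam α)

/-- The set `𝓔` of the elements of `B` with values in `{1, e^α}` a.e. It carries the topology and
the Borel σ-algebra of a subspace of `B`. -/
def stairExtremal {𝒳 : Type} [MeasurableSpace 𝒳] (lam : Measure 𝒳) (α : ℝ) :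
    Set (StairBox lam α) :=
  {r | ∀ᵐ x ∂lam, r.toFun x = 1 ∨ r.toFun x = Real.exp α}

theorem stairSwap_coeFn {𝒳 : Type} [MeasurableSpace 𝒳] {lam : Measure 𝒳} (α : ℝ)
    (f : 𝒳 →ₘ[lam] ℝ) :
    ∀ᵐ x ∂lam, (AEEqFun.const 𝒳 (Real.exp α + 1) - f : 𝒳 →ₘ[lam] ℝ) x
      = Real.exp α + 1 - f x := by
  filter_upwards [AEEqFun.coeFn_sub (AEEqFun.const 𝒳 (Real.exp α + 1)) f,
    AEEqFun.coeFn_const (μ := lam) (α := 𝒳) (Real.exp α + 1)] with x h1 h2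
  rw [h1, Pi.sub_apply, h2, Function.const_apply]

/-- `T(r) = e^α + 1 - r` on `B`. -/
def stairSwap {𝒳 : Type} [MeasurableSpace 𝒳] {lam : Measure 𝒳} {α : ℝ} (r : StairBox lam α) :
    StairBox lam α where
  toFun := AEEqFun.const 𝒳 (Real.exp α + 1) - r.toFun
  bounds := by
    filter_upwards [stairSwap_coeFn α r.toFun, r.bounds] with x h1 h2
    rw [h1]
    constructor <;> linarith [h2.1, h2.2]

theorem stairSwap_mem {𝒳 : Type} [MeasurableSpace 𝒳] {lam : Measure 𝒳} {α : ℝ}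
    {r : StairBox lam α} (hr : r ∈ stairExtremal lam α) : stairSwap r ∈ stairExtremal lam α := by
  have hr' : ∀ᵐ x ∂lam, r.toFun x = 1 ∨ r.toFun x = Real.exp α := hr
  change ∀ᵐ x ∂lam, (stairSwap r).toFun x = 1 ∨ (stairSwap r).toFun x = Real.exp α
  filter_upwards [stairSwap_coeFn α r.toFun, hr'] with x h1 h2
  change (AEEqFun.const 𝒳 (Real.exp α + 1) - r.toFun : 𝒳 →ₘ[lam] ℝ) x = 1 ∨
    (AEEqFun.const 𝒳 (Real.exp α + 1) - r.toFun : 𝒳 →ₘ[lam] ℝ) x = Real.exp α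
  rw [h1]
  rcases h2 with h | h <;> rw [h]
  · right; ring
  · left; ring

/-- `T : 𝓔 → 𝓔`. -/
def stairSwapE {𝒳 : Type} [MeasurableSpace 𝒳] {lam : Measure 𝒳} {α : ℝ}
    (r : stairExtremal lam α) : stairExtremal lam α :=
  ⟨stairSwap r.1, stairSwap_mem r.2⟩

/-- The evaluation operator `(x, r) ↦ e_x(r)`, a version of `r(x)` that depends only on the a.e.
class of `r`: the upper limit of the averages of `r` over shrinking balls around `x`. On an open
subset of `ℝ^d` with Lebesgue measure it equals `r(x)` for a.e. `x`. -/
def stairEval {𝒳 : Type} [MeasurableSpace 𝒳] [PseudoMetricSpace 𝒳] {lam : Measure 𝒳} {α : ℝ}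
    (x : 𝒳) (r : StairBox lam α) : ℝ :=
  limsup (fun n : ℕ => ⨍ y in Metric.closedBall x (1 / ((n : ℝ) + 1)), r.toFun y ∂lam) atTop

/-! ### The optimization problem -/

/-- Radon sub-probability measures `μ` on `𝓔` with `∫ e_x(r) μ(dr) = 1` for a.e. `x`. -/
structure IsStairNormalized {𝒳 : Type} [MeasurableSpace 𝒳] [PseudoMetricSpace 𝒳]
    {lam : Measure 𝒳} {α : ℝ} (μ : Measure (stairExtremal lam α)) : Prop where
  subprob : μ Set.univ ≤ 1
  radon : μ.InnerRegular
  normalized : ∀ᵐ x ∂lam, ∫ r : stairExtremal lam α, stairEval x r.1 ∂μ = 1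

/-- `i(r) = (∫ s r p dx)² / ∫ r p dx` for `r ∈ B`. -/
def stairInfo {𝒳 : Type} [MeasurableSpace 𝒳] {lam : Measure 𝒳} {α : ℝ} (s p : 𝒳 → ℝ)
    (r : StairBox lam α) : ℝ :=
  (∫ x, s x * r.toFun x * p x ∂lam) ^ 2 / ∫ x, r.toFun x * p x ∂lam

/-- `i^{(s)}(r) = (i(r) + i(T r)) / 2` for `r ∈ B`. -/
def stairInfoSym {𝒳 : Type} [MeasurableSpace 𝒳] {lam : Measure 𝒳} {α : ℝ} (s p : 𝒳 → ℝ)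
    (r : StairBox lam α) : ℝ :=
  (1 / 2) * (stairInfo s p r + stairInfo s p (stairSwap r))

/-- The values `∫ i(r) μ(dr)` of the optimization problem. -/
def stairObjectives {𝒳 : Type} [MeasurableSpace 𝒳] [PseudoMetricSpace 𝒳] (lam : Measure 𝒳)
    (α : ℝ) (s p : 𝒳 → ℝ) : Set ℝ :=
  {J | ∃ μ : Measure (stairExtremal lam α), IsStairNormalized μ ∧ J = ∫ r, stairInfo s p r.1 ∂μ}

/-- `μ` solves the optimization problem. -/
def IsStairMaximizer {𝒳 : Type} [MeasurableSpace 𝒳] [PseudoMetricSpace 𝒳] {lam : Measure 𝒳}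
    {α : ℝ} (s p : 𝒳 → ℝ) (μ : Measure (stairExtremal lam α)) : Prop :=
  IsStairNormalized μ ∧
    ∀ μ' : Measure (stairExtremal lam α), IsStairNormalized μ' →
      ∫ r, stairInfo s p r.1 ∂μ' ≤ ∫ r, stairInfo s p r.1 ∂μ

/-- The law of the public variable under the staircase mechanism `q^{(μ)}(x, dr) = e_x(r) μ(dr)`
when the private variable has law `P`, i.e. `(∫ e_x(r) P(dx)) μ(dr)`. -/
def stairPublicLaw {𝒳 : Type} [MeasurableSpace 𝒳] [PseudoMetricSpace 𝒳] {lam : Measure 𝒳}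
    {α : ℝ} (μ : Measure (stairExtremal lam α)) (P : Measure 𝒳) :
    Measure (stairExtremal lam α) :=
  μ.withDensity (fun r => ∫⁻ x, ENNReal.ofReal (stairEval x r.1) ∂P)

/-- The level set `F_r^+ = r⁻¹({e^α})`. -/
def stairLevel {𝒳 : Type} [MeasurableSpace 𝒳] {lam : Measure 𝒳} {α : ℝ} (r : StairBox lam α) :
    Set 𝒳 :=
  {x | r.toFun x = Real.exp α}

/-- Lebesgue measure `dx` on a subset `X` of `ℝ^d`. -/
def lebesgueOn {d : ℕ} (X : Set (EuclideanSpace ℝ (Fin d))) : Measure X :=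
  (volume : Measure (EuclideanSpace ℝ (Fin d))).comap Subtype.val

end

/-! ### Consequences of differentiability in quadratic mean -/

section DQM

variable {Y : Type} [MeasurableSpace Y]

/-! Write `J = ∫ i dμ` for the given symmetric maximizer. Everything follows from two opposite
estimates.

Upper estimate (`sum_info_le`): if finitely many `r_j` in the box and `c_j ≥ 0` satisfy `∑ c_j r_j =
1`, then `∑ c_j i(r_j) ≤ J`. When the `r_j` depend only on a finite label of `x`, each is a convex
combination of functions with values in `{1, e^α}`, and convexity of `a² / b` shows that splitting
it does not lower the value; the general case is a limit. The pair `r`, `T r` with weights `1 / (e^α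
+ 1)` gives `2 / (e^α + 1) * i^{(s)}(r) ≤ J` for every `r` in the box.

Mass estimate (`measureReal_univ_le_of_symmetric`): normalization and symmetry force `μ` to have
mass at most `2 / (e^α + 1)`. Symmetry also gives `∫ i^{(s)} dμ = J`, so the nonnegative function
`(e^α + 1) / 2 * J - i^{(s)}` has integral at most `0`. It vanishes a.e., and since `μ ≠ 0` the
bound is attained.

Private mechanisms: the Fisher information `∫ t²` is the supremum of `∫ (2 g t - g²)` over simple
`g`. Each such integral involves only the finitely many outcomes given by the level sets of `g`;
privacy puts their probabilities, divided by their infima, into the box, so the upper estimate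
applies (`fisherInfo_bind_le`). The binary mechanism of a maximizing `r` attains the bound. Scores
of privatized models are identified by differentiating probabilities, uniformly over bounded test
functions (`IsDQMScore.eventually_abs_integral_sub_le`). -/

theorem modelDensity_nonneg (ν P : Measure Y) (y : Y) : 0 ≤ modelDensity ν P y :=
  ENNReal.toReal_nonneg

theorem measurable_modelDensity (ν P : Measure Y) : Measurable (modelDensity ν P) :=
  (Measure.measurable_rnDeriv P ν).ennreal_toReal

theorem integrable_modelDensity (ν P : Measure Y) [IsFiniteMeasure P] :
    Integrable (modelDensity ν P) ν :=
  Measure.integrable_toReal_rnDeriv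

theorem integral_mul_modelDensity {ν P : Measure Y} [SigmaFinite ν] [IsFiniteMeasure P]
    (h : P ≪ ν) (f : Y → ℝ) : ∫ y, f y * modelDensity ν P y ∂ν = ∫ y, f y ∂P := by
  rw [← integral_toReal_rnDeriv_mul h]
  exact integral_congr_ae (.of_forall fun y => mul_comm _ _)

theorem integrable_mul_modelDensity_iff {ν P : Measure Y} [SigmaFinite ν] [IsFiniteMeasure P]
    (h : P ≪ ν) {f : Y → ℝ} :
    Integrable (fun y => f y * modelDensity ν P y) ν ↔ Integrable f P := by
  rw [← integrable_rnDeriv_smul_iff h]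
  simp only [smul_eq_mul, modelDensity, mul_comm]

/-- The remainder in the definition of differentiability in quadratic mean. -/
noncomputable def dqmRemainder (ν : Measure Y) (P : ℝ → Measure Y) (θ₀ : ℝ) (s : Y → ℝ) (h : ℝ)
    (y : Y) : ℝ :=
  √(modelDensity ν (P (θ₀ + h)) y) - √(modelDensity ν (P θ₀) y)
    - (1 / 2) * h * s y * √(modelDensity ν (P θ₀) y)

variable {ν : Measure Y} {P : ℝ → Measure Y} {θ₀ : ℝ} {s : Y → ℝ}

theorem measurable_dqmRemainder (hs : Measurable s) (h : ℝ) :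
    Measurable (dqmRemainder ν P θ₀ s h) := by
  have h1 := measurable_modelDensity ν (P (θ₀ + h))
  have h2 := measurable_modelDensity ν (P θ₀)
  unfold dqmRemainder
  fun_prop

theorem IsDQMScore.eventually_remainder (hs : IsDQMScore ν P θ₀ s) {δ : ℝ} (hδ : 0 < δ) :
    ∀ᶠ h in 𝓝[≠] (0 : ℝ), Integrable (fun y => dqmRemainder ν P θ₀ s h y ^ 2) ν ∧
      ∫ y, dqmRemainder ν P θ₀ s h y ^ 2 ∂ν ≤ δ * h ^ 2 := by
  have hlt := hs.2.eventually (gt_mem_nhds (ENNReal.ofReal_pos.2 hδ))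
  filter_upwards [hlt, self_mem_nhdsWithin] with h hh h0
  have hpos : 0 < h ^ 2 := (sq_pos_iff).2 h0
  have hle : ∫⁻ y, ENNReal.ofReal (dqmRemainder ν P θ₀ s h y ^ 2) ∂ν
      ≤ ENNReal.ofReal (δ * h ^ 2) := by
    rw [ENNReal.ofReal_mul hδ.le]
    exact (ENNReal.div_le_iff (ENNReal.ofReal_pos.2 hpos).ne' ENNReal.ofReal_ne_top).1 hh.le
  have hm : AEStronglyMeasurable (fun y => dqmRemainder ν P θ₀ s h y ^ 2) ν :=
    ((measurable_dqmRemainder hs.1 h).pow_const 2).aestronglyMeasurable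
  have hint : Integrable (fun y => dqmRemainder ν P θ₀ s h y ^ 2) ν := by
    refine ⟨hm, ?_⟩
    rw [hasFiniteIntegral_iff_ofReal (.of_forall fun y => sq_nonneg _)]
    exact hle.trans_lt ENNReal.ofReal_lt_top
  refine ⟨hint, ?_⟩
  rw [integral_eq_lintegral_of_nonneg_ae (.of_forall fun y => sq_nonneg _) hm]
  exact ENNReal.toReal_le_of_le_ofReal (by positivity) hle

theorem eventually_shift (hP : ∀ᶠ θ in 𝓝 θ₀, IsProbabilityMeasure (P θ) ∧ P θ ≪ ν) :
    ∀ᶠ h in 𝓝 (0 : ℝ),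
    IsProbabilityMeasure (P (θ₀ + h)) ∧ P (θ₀ + h) ≪ ν := by
  have : Tendsto (fun h : ℝ => θ₀ + h) (𝓝 0) (𝓝 θ₀) := by
    have h : Continuous fun h : ℝ => θ₀ + h := by fun_prop
    simpa only [add_zero] using h.tendsto 0
  exact this.eventually hP

/-- A single small `h ≠ 0` suffices: `s √p_{θ₀}` is `2 / h` times a combination of three square
integrable functions, the two root densities and the remainder. The constant `12 / h²` is `(2 / h)²`
times the `3` of `(u - v - w)² ≤ 3 (u² + v² + w²)`. -/
theorem IsDQMScore.integrable_sq_mul (hs : IsDQMScore ν P θ₀ s)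
    (hP : ∀ᶠ θ in 𝓝 θ₀, IsProbabilityMeasure (P θ) ∧ P θ ≪ ν) :
    Integrable (fun y => s y ^ 2 * modelDensity ν (P θ₀) y) ν := by
  obtain ⟨h, ⟨h1, -⟩, h2, h3⟩ := ((hs.eventually_remainder one_pos).and
    ((eventually_nhdsWithin_of_eventually_nhds (eventually_shift hP)).and
      self_mem_nhdsWithin)).exists
  have hh : h ≠ 0 := h3
  have := h2.1
  have := hP.self_of_nhds.1
  have hg : Integrable (fun y => (12 / h ^ 2) * (modelDensity ν (P (θ₀ + h)) y
      + modelDensity ν (P θ₀) y + dqmRemainder ν P θ₀ s h y ^ 2)) ν :=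
    (((integrable_modelDensity ν _).add (integrable_modelDensity ν _)).add h1).const_mul _
  refine hg.mono' (((hs.1.pow_const 2).mul (measurable_modelDensity _ _)).aestronglyMeasurable)
    (.of_forall fun y => ?_)
  have ha := Real.sq_sqrt (modelDensity_nonneg ν (P (θ₀ + h)) y)
  have hb := Real.sq_sqrt (modelDensity_nonneg ν (P θ₀) y)
  rw [Real.norm_of_nonneg (mul_nonneg (sq_nonneg _) (modelDensity_nonneg _ _ _)), div_mul_eq_mul_div,
    le_div_iff₀ (by positivity)]
  unfold dqmRemainder
  rw [← ha, ← hb, Real.sqrt_sq (Real.sqrt_nonneg _), Real.sqrt_sq (Real.sqrt_nonneg _)]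
  generalize √(modelDensity ν (P (θ₀ + h)) y) = a
  generalize √(modelDensity ν (P θ₀) y) = b
  have key : ∀ u v w : ℝ, (u - v - w) ^ 2 ≤ 3 * (u ^ 2 + v ^ 2 + w ^ 2) := fun u v w => by
    nlinarith [sq_nonneg (u + v), sq_nonneg (u + w), sq_nonneg (v - w)]
  have := key a b (a - b - 1 / 2 * h * s y * b)
  nlinarith [this]

theorem IsDQMScore.integrable_mul (hs : IsDQMScore ν P θ₀ s)
    (hP : ∀ᶠ θ in 𝓝 θ₀, IsProbabilityMeasure (P θ) ∧ P θ ≪ ν) :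
    Integrable (fun y => s y * modelDensity ν (P θ₀) y) ν := by
  have := hP.self_of_nhds.1
  refine ((hs.integrable_sq_mul hP).add (integrable_modelDensity ν (P θ₀))).mono'
    (hs.1.mul (measurable_modelDensity _ _)).aestronglyMeasurable (.of_forall fun y => ?_)
  have h0 := modelDensity_nonneg ν (P θ₀) y
  simp only [norm_mul, Real.norm_eq_abs, abs_of_nonneg h0, Pi.add_apply]
  nlinarith [sq_abs (s y), sq_nonneg (|s y| - 1), abs_nonneg (s y),
    mul_nonneg (sq_nonneg (|s y| - 1)) h0, mul_nonneg (abs_nonneg (s y)) h0]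

/-- A model that is differentiable in quadratic mean is differentiable in mean. -/
theorem IsDQMScore.eventually_integral_abs_le (hs : IsDQMScore ν P θ₀ s)
    (hP : ∀ᶠ θ in 𝓝 θ₀, IsProbabilityMeasure (P θ) ∧ P θ ≪ ν) {ε : ℝ} (hε : 0 < ε) :
    ∀ᶠ h in 𝓝 (0 : ℝ), ∫ y, |modelDensity ν (P (θ₀ + h)) y - modelDensity ν (P θ₀) y
      - h * (s y * modelDensity ν (P θ₀) y)| ∂ν ≤ ε * |h| := by
  have := hP.self_of_nhds.1
  set K := ∫ y, s y ^ 2 * modelDensity ν (P θ₀) y ∂ν with hK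
  set M := ∫ y, modelDensity ν (P θ₀) y ∂ν with hM
  have hK0 : 0 ≤ K := integral_nonneg fun y => mul_nonneg (sq_nonneg _) (modelDensity_nonneg _ _ _)
  have hM0 : 0 ≤ M := integral_nonneg fun y => modelDensity_nonneg _ _ _
  -- With `a`, `b` the root densities and `ρ` the remainder, the integrand is `2 ρ b + (ρ + h s b /
  -- 2)²`. The cross term is split by Young's inequality with weight `η |h|`; taking `∫ ρ² ≤ (η ε /
  -- 4) h²` makes each half at most `ε / 4 * |h|`, and the square is of order `h²`.
  obtain ⟨η, hη, hηM⟩ : ∃ η : ℝ, 0 < η ∧ η * M ≤ ε / 4 :=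
    ⟨ε / 4 / (M + 1), by positivity, by
      rw [div_mul_eq_mul_div, div_le_iff₀ (by positivity)]; nlinarith⟩
  have hsmall : ∀ᶠ h in 𝓝 (0 : ℝ), |h| * (2 * (η * ε / 4) + K / 2) ≤ ε / 2 := by
    have : Tendsto (fun h : ℝ => |h| * (2 * (η * ε / 4) + K / 2)) (𝓝 0) (𝓝 0) := by
      have h : Continuous fun h : ℝ => |h| * (2 * (η * ε / 4) + K / 2) := by fun_prop
      simpa only [abs_zero, zero_mul] using h.tendsto 0
    exact (this.eventually (gt_mem_nhds (half_pos hε))).mono fun h hh => hh.le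
  have hrem := eventually_nhdsWithin_iff.1
    (hs.eventually_remainder (δ := η * ε / 4) (by positivity))
  filter_upwards [hsmall, hrem] with h h1 h2
  rcases eq_or_ne h 0 with rfl | h0
  · simp
  obtain ⟨h3, h4⟩ := h2 h0
  have hpos : 0 < |h| := abs_pos.2 h0
  have hsq : |h| ^ 2 = h ^ 2 := sq_abs h
  have hint1 := h3.const_mul (1 / (η * |h|) + 2)
  have hint2 := (integrable_modelDensity ν (P θ₀)).const_mul (η * |h|)
  have hint12 : Integrable (fun y => (1 / (η * |h|) + 2) * dqmRemainder ν P θ₀ s h y ^ 2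
      + η * |h| * modelDensity ν (P θ₀) y) ν := hint1.add hint2
  have hint3 := (hs.integrable_sq_mul hP).const_mul (h ^ 2 / 2)
  calc _ ≤ ∫ y, ((1 / (η * |h|) + 2) * dqmRemainder ν P θ₀ s h y ^ 2
          + η * |h| * modelDensity ν (P θ₀) y
          + h ^ 2 / 2 * (s y ^ 2 * modelDensity ν (P θ₀) y)) ∂ν := by
        refine integral_mono_of_nonneg (.of_forall fun y => abs_nonneg _)
          (hint12.add hint3) (.of_forall fun y => ?_)
        have ha := Real.sq_sqrt (modelDensity_nonneg ν (P (θ₀ + h)) y)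
        have hb := Real.sq_sqrt (modelDensity_nonneg ν (P θ₀) y)
        simp only
        obtain ⟨ρ, hρ⟩ : ∃ ρ, ρ = dqmRemainder ν P θ₀ s h y := ⟨_, rfl⟩
        rw [← hρ]
        unfold dqmRemainder at hρ
        rw [← ha, ← hb]
        generalize √(modelDensity ν (P (θ₀ + h)) y) = a at *
        generalize √(modelDensity ν (P θ₀) y) = b at *
        have e : a = ρ + b + 1 / 2 * h * s y * b := by rw [hρ]; ring
        have e1 : a ^ 2 - b ^ 2 - h * (s y * b ^ 2)
            = 2 * (ρ * b) + (ρ + 1 / 2 * h * s y * b) ^ 2 := by rw [e]; ring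
        have e2 : |2 * (ρ * b)| ≤ 1 / (η * |h|) * ρ ^ 2 + η * |h| * b ^ 2 := by
          set c := η * |h| with hc
          have hc0 : 0 < c := by positivity
          rw [abs_le]
          constructor
          · have : 0 ≤ 1 / c * (ρ + c * b) ^ 2 := by positivity
            have e : 1 / c * (ρ + c * b) ^ 2 = 1 / c * ρ ^ 2 + c * b ^ 2 + 2 * (ρ * b) := by
              field_simp; ring
            linarith
          · have : 0 ≤ 1 / c * (ρ - c * b) ^ 2 := by positivity
            have e : 1 / c * (ρ - c * b) ^ 2 = 1 / c * ρ ^ 2 + c * b ^ 2 - 2 * (ρ * b) := by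
              field_simp; ring
            linarith
        have e3 : (ρ + 1 / 2 * h * s y * b) ^ 2 ≤ 2 * ρ ^ 2 + h ^ 2 / 2 * (s y ^ 2 * b ^ 2) := by
          nlinarith [sq_nonneg (ρ - 1 / 2 * h * s y * b)]
        rw [e1]
        calc _ ≤ |2 * (ρ * b)| + |(ρ + 1 / 2 * h * s y * b) ^ 2| := abs_add_le _ _
          _ ≤ _ := by rw [abs_of_nonneg (sq_nonneg (ρ + 1 / 2 * h * s y * b))]; linarith
    _ = (1 / (η * |h|) + 2) * (∫ y, dqmRemainder ν P θ₀ s h y ^ 2 ∂ν)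
          + η * |h| * M + h ^ 2 / 2 * K := by
        rw [integral_add hint12 hint3, integral_add hint1 hint2, integral_const_mul,
          integral_const_mul, integral_const_mul]
    _ ≤ (1 / (η * |h|) + 2) * (η * ε / 4 * h ^ 2) + η * |h| * M + h ^ 2 / 2 * K := by gcongr
    _ = ε / 4 * |h| + η * M * |h| + |h| * (2 * (η * ε / 4) + K / 2) * |h| := by
        rw [← hsq]; field_simp; ring
    _ ≤ ε / 4 * |h| + ε / 4 * |h| + ε / 2 * |h| := by gcongr
    _ = ε * |h| := by ring

variable [SigmaFinite ν]

theorem IsDQMScore.integrable_sq (hs : IsDQMScore ν P θ₀ s)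
    (hP : ∀ᶠ θ in 𝓝 θ₀, IsProbabilityMeasure (P θ) ∧ P θ ≪ ν) :
    Integrable (fun y => s y ^ 2) (P θ₀) := by
  have := hP.self_of_nhds.1
  exact (integrable_mul_modelDensity_iff hP.self_of_nhds.2).1 (hs.integrable_sq_mul hP)

theorem IsDQMScore.integrable (hs : IsDQMScore ν P θ₀ s)
    (hP : ∀ᶠ θ in 𝓝 θ₀, IsProbabilityMeasure (P θ) ∧ P θ ≪ ν) : Integrable s (P θ₀) := by
  have := hP.self_of_nhds.1
  exact (integrable_mul_modelDensity_iff hP.self_of_nhds.2).1 (hs.integrable_mul hP)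

theorem integrable_of_abs_le {Q : Measure Y} [IsFiniteMeasure Q] {g : Y → ℝ} (hg : Measurable g)
    {C : ℝ} (hC : ∀ y, |g y| ≤ C) : Integrable g Q :=
  (integrable_const C).mono' hg.aestronglyMeasurable (.of_forall hC)

theorem MeasureTheory.Integrable.mul_of_abs_le {Q : Measure Y} {f g : Y → ℝ}
    (hf : Integrable f Q) (hg : Measurable g) {C : ℝ} (hC : ∀ y, |g y| ≤ C) :
    Integrable (fun y => f y * g y) Q :=
  hf.mul_bdd (c := C) hg.aestronglyMeasurable (.of_forall hC)

/-- The expectations of bounded functions are differentiable, uniformly in the function. -/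
theorem IsDQMScore.eventually_abs_integral_sub_le (hs : IsDQMScore ν P θ₀ s)
    (hP : ∀ᶠ θ in 𝓝 θ₀, IsProbabilityMeasure (P θ) ∧ P θ ≪ ν) (C : ℝ) {ε : ℝ}
    (hε : 0 < ε) :
    ∀ᶠ h in 𝓝 (0 : ℝ), ∀ g : Y → ℝ, Measurable g → (∀ y, |g y| ≤ C) →
      |∫ y, g y ∂P (θ₀ + h) - ∫ y, g y ∂P θ₀ - h * ∫ y, s y * g y ∂P θ₀| ≤ ε * |h| := by
  have := hP.self_of_nhds.1
  have hC1 : 0 < |C| + 1 := by positivity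
  filter_upwards [hs.eventually_integral_abs_le hP (div_pos hε hC1), eventually_shift hP]
    with h h1 h2 g hg hgC
  have := h2.1
  have i1 : Integrable (fun y => g y * modelDensity ν (P (θ₀ + h)) y) ν :=
    (integrable_mul_modelDensity_iff h2.2).2 (integrable_of_abs_le hg hgC)
  have i2 : Integrable (fun y => g y * modelDensity ν (P θ₀) y) ν :=
    (integrable_mul_modelDensity_iff hP.self_of_nhds.2).2 (integrable_of_abs_le hg hgC)
  have i3 : Integrable (fun y => (s y * g y) * modelDensity ν (P θ₀) y) ν :=
    (integrable_mul_modelDensity_iff hP.self_of_nhds.2).2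
      ((hs.integrable hP).mul_of_abs_le hg hgC)
  have i12 : Integrable (fun y => g y * modelDensity ν (P (θ₀ + h)) y
      - g y * modelDensity ν (P θ₀) y) ν := i1.sub i2
  rw [← integral_mul_modelDensity h2.2, ← integral_mul_modelDensity hP.self_of_nhds.2,
    ← integral_mul_modelDensity hP.self_of_nhds.2, ← integral_const_mul, ← integral_sub i1 i2,
    ← integral_sub i12 (i3.const_mul h)]
  have i4 : Integrable (fun y => modelDensity ν (P (θ₀ + h)) y - modelDensity ν (P θ₀) y
      - h * (s y * modelDensity ν (P θ₀) y)) ν :=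
    ((integrable_modelDensity _ _).sub (integrable_modelDensity _ _)).sub
      ((hs.integrable_mul hP).const_mul h)
  calc _ ≤ ∫ y, |g y * modelDensity ν (P (θ₀ + h)) y - g y * modelDensity ν (P θ₀) y
          - h * (s y * g y * modelDensity ν (P θ₀) y)| ∂ν := abs_integral_le_integral_abs
    _ ≤ ∫ y, (|C| + 1) * |modelDensity ν (P (θ₀ + h)) y - modelDensity ν (P θ₀) y
          - h * (s y * modelDensity ν (P θ₀) y)| ∂ν := by
        refine integral_mono_of_nonneg (.of_forall fun y => abs_nonneg _)
          (i4.abs.const_mul _) (.of_forall fun y => ?_)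
        simp only
        rw [show g y * modelDensity ν (P (θ₀ + h)) y - g y * modelDensity ν (P θ₀) y
          - h * (s y * g y * modelDensity ν (P θ₀) y) = g y * (modelDensity ν (P (θ₀ + h)) y
            - modelDensity ν (P θ₀) y - h * (s y * modelDensity ν (P θ₀) y)) by ring, abs_mul]
        gcongr
        exact (hgC y).trans ((le_abs_self C).trans (by linarith))
    _ ≤ (|C| + 1) * (ε / (|C| + 1) * |h|) := by
        rw [integral_const_mul]; gcongr
    _ = ε * |h| := by field_simp

theorem IsDQMScore.hasDerivAt_integral (hs : IsDQMScore ν P θ₀ s)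
    (hP : ∀ᶠ θ in 𝓝 θ₀, IsProbabilityMeasure (P θ) ∧ P θ ≪ ν) {g : Y → ℝ} (hg : Measurable g)
    {C : ℝ} (hC : ∀ y, |g y| ≤ C) :
    HasDerivAt (fun θ => ∫ y, g y ∂P θ) (∫ y, s y * g y ∂P θ₀) θ₀ := by
  rw [hasDerivAt_iff_isLittleO_nhds_zero, Asymptotics.isLittleO_iff]
  intro ε hε
  filter_upwards [hs.eventually_abs_integral_sub_le hP C hε] with h hh
  simpa using hh g hg hC

/-- The integral of the score is the derivative of the total mass, which is constant near `θ₀`. -/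
theorem IsDQMScore.integral_eq_zero (hs : IsDQMScore ν P θ₀ s)
    (hP : ∀ᶠ θ in 𝓝 θ₀, IsProbabilityMeasure (P θ) ∧ P θ ≪ ν) : ∫ y, s y ∂P θ₀ = 0 := by
  have h1 := hs.hasDerivAt_integral hP (g := fun _ => 1) measurable_const (C := 1) (by simp)
  have h2 : HasDerivAt (fun θ => ∫ y, (1 : ℝ) ∂P θ) 0 θ₀ := by
    refine (hasDerivAt_const θ₀ (1 : ℝ)).congr_of_eventuallyEq ?_
    filter_upwards [hP] with θ hθ
    have := hθ.1
    simp
  simpa using h1.unique h2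

end DQM

/-! ### Fisher information of models with uniformly differentiable densities -/

section UniformDensity

/-- With `A = √a` and `B = √b` the left side is exactly `|-(B - A)² / (2A) + (b - a - h g) / (2A)|`.
The lower bound `1` removes the denominators and gives `(B - A)² ≤ (b - a)²` through the factor `(B
+ A)²`. -/
theorem abs_sqrt_sub_sqrt_sub_le {a b g h : ℝ} (ha : 1 ≤ a) (hb : 1 ≤ b) :
    |√b - √a - (1 / 2) * h * (g / a) * √a| ≤ (b - a) ^ 2 + |b - a - h * g| := by
  have hA : 1 ≤ √a := Real.one_le_sqrt.2 ha
  have hB : 1 ≤ √b := Real.one_le_sqrt.2 hb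
  have ea : a = √a ^ 2 := (Real.sq_sqrt (by linarith)).symm
  have eb : b = √b ^ 2 := (Real.sq_sqrt (by linarith)).symm
  generalize √a = A at *
  generalize √b = B at *
  subst ea eb
  have hA0 : 0 < A := by linarith
  have e : B - A - 1 / 2 * h * (g / A ^ 2) * A
      = -((B - A) ^ 2 / (2 * A)) + (B ^ 2 - A ^ 2 - h * g) / (2 * A) := by
    field_simp; ring
  have h1 : (B - A) ^ 2 / (2 * A) ≤ (B ^ 2 - A ^ 2) ^ 2 := by
    calc (B - A) ^ 2 / (2 * A) ≤ (B - A) ^ 2 := div_le_self (sq_nonneg _) (by linarith)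
      _ = (B - A) ^ 2 * 1 := (mul_one _).symm
      _ ≤ (B - A) ^ 2 * (B + A) ^ 2 := by
        gcongr
        nlinarith
      _ = _ := by ring
  have h2 : |(B ^ 2 - A ^ 2 - h * g) / (2 * A)| ≤ |B ^ 2 - A ^ 2 - h * g| := by
    rw [abs_div, abs_of_pos (by linarith : 0 < 2 * A)]
    exact div_le_self (abs_nonneg _) (by linarith)
  rw [e]
  calc _ ≤ |-((B - A) ^ 2 / (2 * A))| + |(B ^ 2 - A ^ 2 - h * g) / (2 * A)| := abs_add_le _ _
    _ ≤ _ := by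
      rw [abs_neg, abs_of_nonneg (by positivity)]
      exact add_le_add h1 h2

variable {Y : Type} [MeasurableSpace Y]

theorem modelDensity_withDensity_ofReal (ν : Measure Y) [SigmaFinite ν] {f : Y → ℝ}
    (hf : Measurable f) (hf0 : ∀ y, 0 ≤ f y) :
    modelDensity ν (ν.withDensity fun y => ENNReal.ofReal (f y)) =ᵐ[ν] f := by
  filter_upwards [Measure.rnDeriv_withDensity ν hf.ennreal_ofReal] with y hy
  rw [modelDensity, hy, ENNReal.toReal_ofReal (hf0 y)]

/-- A model whose densities with respect to a finite measure are bounded below by `1` and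
differentiable in the parameter, uniformly in the observation, is differentiable in quadratic
mean, and its score is the logarithmic derivative of the density. -/
theorem hasFisherInfo_of_uniformly_differentiable {Θ : Set ℝ} {θ₀ : ℝ} (hθ₀ : θ₀ ∈ interior Θ)
    (ν : Measure Y) [IsFiniteMeasure ν] {R : ℝ → Measure Y} {f : ℝ → Y → ℝ} {g : Y → ℝ}
    (hg : Measurable g) {C : ℝ} (hgC : ∀ y, |g y| ≤ C) (hf : ∀ θ ∈ Θ, Measurable (f θ))
    (hf1 : ∀ θ ∈ Θ, ∀ y, 1 ≤ f θ y)
    (hR : ∀ θ ∈ Θ, R θ = ν.withDensity fun y => ENNReal.ofReal (f θ y))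
    (hd : ∀ ε > 0, ∀ᶠ h in 𝓝 (0 : ℝ), ∀ y, |f (θ₀ + h) y - f θ₀ y - h * g y| ≤ ε * |h|) :
    HasFisherInfo Θ R θ₀ (∫ y, g y ^ 2 / f θ₀ y ∂ν) := by
  have hmem : θ₀ ∈ Θ := interior_subset hθ₀
  have hd0 : ∀ θ ∈ Θ, modelDensity ν (R θ) =ᵐ[ν] f θ := fun θ hθ => by
    rw [hR θ hθ]
    exact modelDensity_withDensity_ofReal ν (hf θ hθ) fun y => zero_le_one.trans (hf1 θ hθ y)
  refine ⟨ν, inferInstance, fun θ hθ => ?_, fun y => g y / f θ₀ y,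
    ⟨hg.div (hf θ₀ hmem), ?_⟩, ?_⟩
  · rw [hR θ hθ]
    exact withDensity_absolutelyContinuous _ _
  · rw [ENNReal.tendsto_nhds_zero]
    intro ε hε
    -- The remainder will be at most `2 η |h|` at almost every point: `η |h|` from the linearization
    -- error and `η |h|` from the squared increment of the density.
    obtain ⟨η, hη, hηε⟩ : ∃ η : ℝ, 0 < η ∧ ENNReal.ofReal ((2 * η) ^ 2) * ν Set.univ ≤ ε := by
      rcases eq_or_ne ε ⊤ with rfl | htop
      · exact ⟨1, one_pos, le_top⟩
      have hε0 : 0 < ε.toReal := ENNReal.toReal_pos hε.ne' htop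
      have hM : 0 < ν.real Set.univ + 1 := by positivity
      refine ⟨√(ε.toReal / (ν.real Set.univ + 1)) / 2, by positivity, ?_⟩
      rw [mul_div_cancel₀ _ two_ne_zero, Real.sq_sqrt (by positivity),
        ← ofReal_measureReal (measure_ne_top ν _), ← ENNReal.ofReal_mul (by positivity)]
      refine ENNReal.ofReal_le_of_le_toReal ?_
      rw [div_mul_eq_mul_div, div_le_iff₀ hM]
      nlinarith
    have hC0 : ∀ᶠ h in 𝓝 (0 : ℝ), |h| * (η + C) ^ 2 ≤ η := by
      have h : Continuous fun h : ℝ => |h| * (η + C) ^ 2 := by fun_prop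
      have h' := h.tendsto 0
      simp only [abs_zero, zero_mul] at h'
      exact (h'.eventually (gt_mem_nhds hη)).mono fun h hh => hh.le
    have hΘ : ∀ᶠ h in 𝓝 (0 : ℝ), θ₀ + h ∈ Θ := by
      have h : Continuous fun h : ℝ => θ₀ + h := by fun_prop
      have h' := h.tendsto 0
      rw [add_zero] at h'
      exact h'.eventually (mem_interior_iff_mem_nhds.1 hθ₀)
    filter_upwards [self_mem_nhdsWithin, eventually_nhdsWithin_of_eventually_nhds (hd η hη),
      eventually_nhdsWithin_of_eventually_nhds hC0,
      eventually_nhdsWithin_of_eventually_nhds hΘ] with h h0 h1 h2 h3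
    have hpos : 0 < h ^ 2 := sq_pos_iff.2 h0
    refine ENNReal.div_le_of_le_mul ?_
    calc _ ≤ ∫⁻ _, ENNReal.ofReal ((2 * η) ^ 2 * h ^ 2) ∂ν := by
          refine lintegral_mono_ae ?_
          filter_upwards [hd0 _ h3, hd0 _ hmem] with y hy hy0
          rw [hy, hy0]
          refine ENNReal.ofReal_le_ofReal ?_
          rw [← mul_pow]
          refine sq_le_sq.2 ((abs_sqrt_sub_sqrt_sub_le (hf1 _ hmem y) (hf1 _ h3 y)).trans ?_)
          have hb : |f (θ₀ + h) y - f θ₀ y| ≤ (η + C) * |h| := by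
            calc _ = |(f (θ₀ + h) y - f θ₀ y - h * g y) + h * g y| := by ring_nf
              _ ≤ |f (θ₀ + h) y - f θ₀ y - h * g y| + |h * g y| := abs_add_le _ _
              _ ≤ η * |h| + |h| * C := by
                rw [abs_mul h]
                exact add_le_add (h1 y) (mul_le_mul_of_nonneg_left (hgC y) (abs_nonneg _))
              _ = _ := by ring
          have hsq : (f (θ₀ + h) y - f θ₀ y) ^ 2 ≤ η * |h| := by
            calc _ = |f (θ₀ + h) y - f θ₀ y| ^ 2 := (sq_abs _).symm
              _ ≤ ((η + C) * |h|) ^ 2 := by gcongr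
              _ = |h| * (η + C) ^ 2 * |h| := by ring
              _ ≤ _ := by gcongr
          rw [abs_mul, abs_of_pos (by positivity : 0 < 2 * η)]
          linarith [h1 y]
      _ = ENNReal.ofReal ((2 * η) ^ 2) * ν Set.univ * ENNReal.ofReal (h ^ 2) := by
          rw [lintegral_const, ENNReal.ofReal_mul (by positivity)]; ring
      _ ≤ _ := by gcongr
  · rw [hR θ₀ hmem, integral_withDensity_eq_integral_toReal_smul (hf θ₀ hmem).ennreal_ofReal
      (.of_forall fun _ => ENNReal.ofReal_lt_top)]
    refine integral_congr_ae (.of_forall fun y => ?_)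
    have := hf1 θ₀ hmem y
    have h0 : f θ₀ y ≠ 0 := by positivity
    simp only [smul_eq_mul]
    rw [ENNReal.toReal_ofReal (by linarith)]
    field_simp

end UniformDensity

/-! ### The space `B` with the weak-star topology -/

section StairBox

variable {𝒳 : Type} [MeasurableSpace 𝒳] {lam : Measure 𝒳} {α : ℝ}

instance StairBox.instBorelSpace : BorelSpace (StairBox lam α) := ⟨rfl⟩

theorem StairBox.measurable_toFun (r : StairBox lam α) : Measurable (r.toFun : 𝒳 → ℝ) :=
  r.toFun.stronglyMeasurable.measurable

theorem StairBox.ae_abs_le (r : StairBox lam α) : ∀ᵐ x ∂lam, |r.toFun x| ≤ Real.exp α := by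
  filter_upwards [r.bounds] with x hx
  rw [abs_of_nonneg (zero_le_one.trans hx.1)]
  exact hx.2

theorem StairBox.integrable_mul (r : StairBox lam α) {f : 𝒳 → ℝ} (hf : Integrable f lam) :
    Integrable (fun x => f x * r.toFun x) lam :=
  hf.mul_bdd (c := Real.exp α) r.measurable_toFun.aestronglyMeasurable r.ae_abs_le

theorem StairBox.continuous_integral_mul {f : 𝒳 → ℝ} (hf : Integrable f lam) :
    Continuous fun r : StairBox lam α => ∫ x, f x * r.toFun x ∂lam := by
  have h : Continuous fun r : StairBox lam α => ∫ x, (hf.toL1 f) x * r.toFun x ∂lam :=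
    continuous_iInf_dom (i := hf.toL1 f) continuous_induced_dom
  refine h.congr fun r => integral_congr_ae ?_
  filter_upwards [hf.coeFn_toL1] with x hx
  rw [hx]

/-- The element of `B` given by a function with values in `[1, e^α]`. -/
def StairBox.mk' (lam : Measure 𝒳) {α : ℝ} (u : 𝒳 → ℝ) (hu : Measurable u)
    (hb : ∀ x, 1 ≤ u x ∧ u x ≤ Real.exp α) : StairBox lam α where
  toFun := AEEqFun.mk u hu.aestronglyMeasurable
  bounds := by
    filter_upwards [AEEqFun.coeFn_mk u (μ := lam) hu.aestronglyMeasurable] with x hx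
    rw [hx]
    exact hb x

theorem StairBox.coeFn_mk' (u : 𝒳 → ℝ) (hu : Measurable u)
    (hb : ∀ x, 1 ≤ u x ∧ u x ≤ Real.exp α) : (StairBox.mk' lam u hu hb).toFun =ᵐ[lam] u :=
  AEEqFun.coeFn_mk u hu.aestronglyMeasurable

/-- Truncation turns the a.e. bounds into bounds everywhere, as the uniform derivative estimate and
the construction of kernels require. -/
theorem StairBox.exists_representative (hα : 0 < α) (r : StairBox lam α) :
    ∃ u : 𝒳 → ℝ, Measurable u ∧ (∀ x, 1 ≤ u x ∧ u x ≤ Real.exp α) ∧ r.toFun =ᵐ[lam] u := by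
  have h1 : 1 ≤ Real.exp α := Real.one_le_exp hα.le
  refine ⟨fun x => max 1 (min (r.toFun x) (Real.exp α)),
    measurable_const.max (r.measurable_toFun.min measurable_const),
    fun x => ⟨le_max_left _ _, max_le h1 (min_le_right _ _)⟩, ?_⟩
  filter_upwards [r.bounds] with x hx
  rw [min_eq_left hx.2, max_eq_right hx.1]

theorem stairSwap_ae (r : StairBox lam α) :
    ∀ᵐ x ∂lam, (stairSwap r).toFun x = Real.exp α + 1 - r.toFun x :=
  stairSwap_coeFn α r.toFun

theorem integral_mul_stairSwap (r : StairBox lam α) {f : 𝒳 → ℝ} (hf : Integrable f lam) :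
    ∫ x, f x * (stairSwap r).toFun x ∂lam
      = (Real.exp α + 1) * ∫ x, f x ∂lam - ∫ x, f x * r.toFun x ∂lam := by
  rw [← integral_const_mul, ← integral_sub (hf.const_mul _) (r.integrable_mul hf)]
  refine integral_congr_ae ?_
  filter_upwards [stairSwap_ae r] with x hx
  rw [hx]; ring

theorem continuous_stairSwap : Continuous (stairSwap : StairBox lam α → StairBox lam α) := by
  refine continuous_iInf_rng.2 fun f => continuous_induced_rng.2 ?_
  have hf : Integrable f lam := L1.integrable_coeFn f
  have h : Continuous fun r : StairBox lam α =>
      (Real.exp α + 1) * ∫ x, f x ∂lam - ∫ x, f x * r.toFun x ∂lam :=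
    continuous_const.sub (StairBox.continuous_integral_mul hf)
  exact h.congr fun r => (integral_mul_stairSwap r hf).symm

theorem measurable_stairSwapE :
    Measurable (stairSwapE : stairExtremal lam α → stairExtremal lam α) :=
  (continuous_stairSwap.measurable.comp measurable_subtype_coe).subtype_mk

end StairBox

/-! ### The information functional -/

section StairInfo

variable {𝒳 : Type} [MeasurableSpace 𝒳] {lam : Measure 𝒳} {α : ℝ}

theorem abs_integral_mul_stairBox_le {P₀ : Measure 𝒳} (hP : P₀ ≪ lam) {s : 𝒳 → ℝ} (hs : Integrable s P₀)
    (r : StairBox lam α) : |∫ x, s x * r.toFun x ∂P₀| ≤ Real.exp α * ∫ x, |s x| ∂P₀ := by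
  rw [← integral_const_mul]
  refine abs_integral_le_integral_abs.trans
    (integral_mono_of_nonneg (.of_forall fun x => abs_nonneg _) (hs.abs.const_mul _) ?_)
  filter_upwards [hP.ae_le r.ae_abs_le] with x hx
  rw [abs_mul, mul_comm]
  gcongr

variable {P₀ : Measure 𝒳} [IsProbabilityMeasure P₀]

theorem one_le_integral_and_le {u : 𝒳 → ℝ} {c : ℝ} (hu : Measurable u)
    (hb : ∀ᵐ x ∂P₀, 1 ≤ u x ∧ u x ≤ c) : 1 ≤ ∫ x, u x ∂P₀ ∧ ∫ x, u x ∂P₀ ≤ c := by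
  have hi : Integrable u P₀ := by
    refine (integrable_const c).mono' hu.aestronglyMeasurable ?_
    filter_upwards [hb] with x hx
    rw [Real.norm_of_nonneg (zero_le_one.trans hx.1)]
    exact hx.2
  constructor
  · simpa using integral_mono_ae (integrable_const (1 : ℝ)) hi (hb.mono fun x hx => hx.1)
  · simpa using integral_mono_ae hi (integrable_const c) (hb.mono fun x hx => hx.2)

theorem StairBox.one_le_integral_and_le (hP : P₀ ≪ lam) (r : StairBox lam α) :
    1 ≤ ∫ x, r.toFun x ∂P₀ ∧ ∫ x, r.toFun x ∂P₀ ≤ Real.exp α :=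
  _root_.one_le_integral_and_le r.measurable_toFun (hP.ae_le r.bounds)

variable [SigmaFinite lam]

/-- The information functional, expressed by means of the measure `P₀` with density `p`. -/
theorem stairInfo_eq (hP : P₀ ≪ lam) (s : 𝒳 → ℝ) (r : StairBox lam α) :
    stairInfo s (modelDensity lam P₀) r
      = (∫ x, s x * r.toFun x ∂P₀) ^ 2 / ∫ x, r.toFun x ∂P₀ := by
  rw [stairInfo, integral_mul_modelDensity hP, integral_mul_modelDensity hP]

theorem continuous_integral_stairBox (hP : P₀ ≪ lam) :
    Continuous fun r : StairBox lam α => ∫ x, r.toFun x ∂P₀ := by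
  refine (StairBox.continuous_integral_mul (integrable_modelDensity lam P₀)).congr fun r => ?_
  rw [← integral_mul_modelDensity hP]
  simp only [mul_comm]

theorem continuous_integral_mul_stairBox (hP : P₀ ≪ lam) {s : 𝒳 → ℝ} (hs : Integrable s P₀) :
    Continuous fun r : StairBox lam α => ∫ x, s x * r.toFun x ∂P₀ := by
  refine (StairBox.continuous_integral_mul
    ((integrable_mul_modelDensity_iff hP).2 hs)).congr fun r => ?_
  rw [← integral_mul_modelDensity hP]
  exact integral_congr_ae (.of_forall fun x => by ring)

/-- Numerator and denominator come from pairings with the `L¹` functions `s p` and `p`, and the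
denominator is at least `1`. This supplies the Borel measurability of `i`. -/
theorem continuous_stairInfo (hP : P₀ ≪ lam) {s : 𝒳 → ℝ} (hs : Integrable s P₀) :
    Continuous fun r : StairBox lam α => stairInfo s (modelDensity lam P₀) r := by
  simp only [stairInfo_eq hP]
  refine ((continuous_integral_mul_stairBox hP hs).pow 2).div (continuous_integral_stairBox hP)
    fun r => ?_
  exact (zero_lt_one.trans_le (r.one_le_integral_and_le hP).1).ne'

theorem stairInfo_nonneg (hP : P₀ ≪ lam) (s : 𝒳 → ℝ) (r : StairBox lam α) :
    0 ≤ stairInfo s (modelDensity lam P₀) r := by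
  rw [stairInfo_eq hP]
  exact div_nonneg (sq_nonneg _) (zero_le_one.trans (r.one_le_integral_and_le hP).1)

theorem stairInfo_le (hP : P₀ ≪ lam) {s : 𝒳 → ℝ} (hs : Integrable s P₀) (r : StairBox lam α) :
    stairInfo s (modelDensity lam P₀) r ≤ (Real.exp α * ∫ x, |s x| ∂P₀) ^ 2 := by
  rw [stairInfo_eq hP]
  refine (div_le_self (sq_nonneg _) (r.one_le_integral_and_le hP).1).trans ?_
  exact sq_le_sq' (abs_le.1 (abs_integral_mul_stairBox_le hP hs r)).1
    (abs_le.1 (abs_integral_mul_stairBox_le hP hs r)).2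

theorem stairInfo_mk' (hP : P₀ ≪ lam) (s : 𝒳 → ℝ) {u : 𝒳 → ℝ} {r : StairBox lam α}
    (hu : r.toFun =ᵐ[lam] u) :
    stairInfo s (modelDensity lam P₀) r = (∫ x, s x * u x ∂P₀) ^ 2 / ∫ x, u x ∂P₀ := by
  rw [stairInfo_eq hP]
  have h : r.toFun =ᵐ[P₀] u := hP.ae_eq hu
  rw [integral_congr_ae h, integral_congr_ae (h.mono fun x hx => by simp only [hx] :
    (fun x => s x * r.toFun x) =ᵐ[P₀] fun x => s x * u x)]

theorem integrable_stairInfo (hP : P₀ ≪ lam) {s : 𝒳 → ℝ} (hs : Integrable s P₀)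
    (μ : Measure (stairExtremal lam α)) [IsFiniteMeasure μ] :
    Integrable (fun r => stairInfo s (modelDensity lam P₀) r.1) μ := by
  refine (integrable_const ((Real.exp α * ∫ x, |s x| ∂P₀) ^ 2)).mono'
    ((continuous_stairInfo hP hs).measurable.comp measurable_subtype_coe).aestronglyMeasurable
    (.of_forall fun r => ?_)
  rw [Real.norm_of_nonneg (stairInfo_nonneg hP s r.1)]
  exact stairInfo_le hP hs r.1

end StairInfo

/-! ### Lebesgue measure on an open set and the evaluation operator -/

section Lebesgue

variable {d : ℕ} {X : Set (EuclideanSpace ℝ (Fin d))} {α : ℝ}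

theorem map_lebesgueOn (hX : IsOpen X) :
    (lebesgueOn X).map Subtype.val = volume.restrict X :=
  map_comap_subtype_coe hX.measurableSet _

theorem sigmaFinite_lebesgueOn (hX : IsOpen X) : SigmaFinite (lebesgueOn X) := by
  refine SigmaFinite.of_map _ (f := Subtype.val) measurable_subtype_coe.aemeasurable ?_
  rw [map_lebesgueOn hX]
  infer_instance

theorem lebesgueOn_apply (hX : IsOpen X) (A : Set X) :
    lebesgueOn X A = volume (Subtype.val '' A) :=
  comap_subtype_coe_apply hX.measurableSet _ _

theorem lebesgueOn_closedBall_ne_top (hX : IsOpen X) (x : X) (δ : ℝ) :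
    lebesgueOn X (Metric.closedBall x δ) ≠ ⊤ := by
  rw [lebesgueOn_apply hX]
  refine ne_top_of_le_ne_top (measure_closedBall_lt_top (x := (x : EuclideanSpace ℝ (Fin d)))
    (r := δ)).ne (measure_mono ?_)
  rintro _ ⟨y, hy, rfl⟩
  exact hy

theorem lebesgueOn_closedBall_pos (hX : IsOpen X) (x : X) {δ : ℝ} (hδ : 0 < δ) :
    0 < lebesgueOn X (Metric.closedBall x δ) := by
  rw [lebesgueOn_apply hX]
  refine lt_of_lt_of_le ((hX.inter Metric.isOpen_ball).measure_pos volume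
    ⟨(x : EuclideanSpace ℝ (Fin d)), x.2, Metric.mem_ball_self hδ⟩) (measure_mono ?_)
  rintro y ⟨hy, hy'⟩
  exact ⟨⟨y, hy⟩, (Metric.mem_ball.1 hy').le, rfl⟩

theorem ae_lebesgueOn_neBot (hX : IsOpen X) [Nonempty X] : (ae (lebesgueOn X)).NeBot := by
  rw [ae_neBot]
  intro h0
  have := lebesgueOn_closedBall_pos hX (Classical.arbitrary X) one_pos
  simp [h0] at this

/-- The average of `r` over the ball of radius `1 / (n + 1)` around `x`. -/
noncomputable def stairAverage (n : ℕ) (x : X) (r : StairBox (lebesgueOn X) α) : ℝ :=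
  ⨍ y in Metric.closedBall x (1 / ((n : ℝ) + 1)), r.toFun y ∂(lebesgueOn X)

/-- The density of the uniform distribution on the ball of radius `1 / (n + 1)` around `x`. -/
noncomputable def ballDensity (n : ℕ) (x : X) : X → ℝ :=
  (Metric.closedBall x (1 / ((n : ℝ) + 1))).indicator
    fun _ => ((lebesgueOn X).real (Metric.closedBall x (1 / ((n : ℝ) + 1))))⁻¹

theorem ballDensity_nonneg (n : ℕ) (x y : X) : 0 ≤ ballDensity n x y :=
  Set.indicator_nonneg (fun _ _ => by positivity) _

theorem integrable_ballDensity (hX : IsOpen X) (n : ℕ) (x : X) :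
    Integrable (ballDensity n x) (lebesgueOn X) :=
  (integrable_indicator_iff Metric.isClosed_closedBall.measurableSet).2
    (integrableOn_const (lebesgueOn_closedBall_ne_top hX x _))

theorem integral_ballDensity (hX : IsOpen X) (n : ℕ) (x : X) :
    ∫ y, ballDensity n x y ∂(lebesgueOn X) = 1 := by
  rw [ballDensity, integral_indicator Metric.isClosed_closedBall.measurableSet, setIntegral_const,
    smul_eq_mul]
  refine mul_inv_cancel₀ (ENNReal.toReal_pos (lebesgueOn_closedBall_pos hX x ?_).ne'
    (lebesgueOn_closedBall_ne_top hX x _)).ne'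
  positivity

theorem stairAverage_eq (n : ℕ) (x : X) (r : StairBox (lebesgueOn X) α) :
    stairAverage n x r = ∫ y, ballDensity n x y * r.toFun y ∂(lebesgueOn X) := by
  rw [stairAverage, setAverage_eq, smul_eq_mul, ← integral_const_mul,
    ← integral_indicator Metric.isClosed_closedBall.measurableSet]
  refine integral_congr_ae (.of_forall fun y => ?_)
  simp only [ballDensity, ← Set.indicator_mul_left]

/-- A ball average is a pairing with an `L¹` function, hence weak-star continuous; the countable
upper limit is then Borel in `r`. -/
theorem continuous_stairAverage (hX : IsOpen X) (n : ℕ) (x : X) :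
    Continuous fun r : StairBox (lebesgueOn X) α => stairAverage n x r := by
  simp only [stairAverage_eq]
  exact StairBox.continuous_integral_mul (integrable_ballDensity hX n x)

theorem stairAverage_stairSwap (hX : IsOpen X) (n : ℕ) (x : X)
    (r : StairBox (lebesgueOn X) α) :
    stairAverage n x (stairSwap r) = Real.exp α + 1 - stairAverage n x r := by
  rw [stairAverage_eq, stairAverage_eq, integral_mul_stairSwap r (integrable_ballDensity hX n x),
    integral_ballDensity hX, mul_one]

theorem stairAverage_mem_Icc (hX : IsOpen X) (n : ℕ) (x : X) (r : StairBox (lebesgueOn X) α) :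
    stairAverage n x r ∈ Set.Icc 1 (Real.exp α) := by
  have hi := integrable_ballDensity hX n x
  rw [stairAverage_eq]
  constructor
  · rw [← integral_ballDensity hX n x]
    refine integral_mono_ae hi (r.integrable_mul hi) ?_
    filter_upwards [r.bounds] with y hy
    exact le_mul_of_one_le_right (ballDensity_nonneg n x y) hy.1
  · calc _ ≤ ∫ y, ballDensity n x y * Real.exp α ∂(lebesgueOn X) := by
          refine integral_mono_ae (r.integrable_mul hi) (hi.mul_const _) ?_
          filter_upwards [r.bounds] with y hy
          exact mul_le_mul_of_nonneg_left hy.2 (ballDensity_nonneg n x y)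
      _ = Real.exp α := by rw [integral_mul_const, integral_ballDensity hX, one_mul]

theorem stairEval_eq (x : X) (r : StairBox (lebesgueOn X) α) :
    stairEval x r = limsup (fun n => stairAverage n x r) atTop := rfl

theorem measurable_stairEval (hX : IsOpen X) (x : X) :
    Measurable fun r : StairBox (lebesgueOn X) α => stairEval x r :=
  Measurable.limsup fun n => (continuous_stairAverage hX n x).measurable

/-- The Lebesgue differentiation theorem for the evaluation operator. -/
theorem stairEval_ae (hX : IsOpen X) (r : StairBox (lebesgueOn X) α) :
    ∀ᵐ x ∂(lebesgueOn X), stairEval x r = r.toFun x := by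
  have hemb : MeasurableEmbedding (Subtype.val : X → EuclideanSpace ℝ (Fin d)) :=
    MeasurableEmbedding.subtype_coe hX.measurableSet
  obtain ⟨F, hFm, hF⟩ := hemb.exists_measurable_extend r.measurable_toFun
    (fun _ => ⟨0⟩)
  have hb : ∀ᵐ y ∂(volume.restrict X), 1 ≤ F y ∧ F y ≤ Real.exp α := by
    rw [← map_lebesgueOn hX, hemb.ae_map_iff]
    filter_upwards [r.bounds] with x hx
    have := congrFun hF x
    simp only [Function.comp_apply] at this
    rw [this]
    exact hx
  -- Extension by zero to all of `ℝ^d` makes the Lebesgue differentiation theorem applicable.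
  have hloc : LocallyIntegrable (X.indicator F) volume := by
    refine (locallyIntegrable_const (Real.exp α)).mono
      (hFm.indicator hX.measurableSet).aestronglyMeasurable ?_
    filter_upwards [(ae_restrict_iff' hX.measurableSet).1 hb] with y hy
    by_cases hyX : y ∈ X
    · rw [Set.indicator_of_mem hyX, Real.norm_of_nonneg (zero_le_one.trans (hy hyX).1),
        Real.norm_of_nonneg (Real.exp_nonneg _)]
      exact (hy hyX).2
    · rw [Set.indicator_of_notMem hyX, norm_zero]
      exact norm_nonneg _
  have hLeb := IsUnifLocDoublingMeasure.ae_tendsto_average volume hloc 1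
  have hLeb' := ae_restrict_of_ae (s := X) hLeb
  rw [← map_lebesgueOn hX, hemb.ae_map_iff] at hLeb'
  filter_upwards [hLeb'] with x hx
  have hδ : Tendsto (fun n : ℕ => 1 / ((n : ℝ) + 1)) atTop (𝓝[>] 0) :=
    tendsto_nhdsWithin_iff.2 ⟨tendsto_one_div_add_atTop_nhds_zero_nat,
      .of_forall fun n => Set.mem_Ioi.2 (by positivity)⟩
  have hlim := hx (fun _ => (x : EuclideanSpace ℝ (Fin d))) (fun n : ℕ => 1 / ((n : ℝ) + 1)) hδ
    (.of_forall fun n => Metric.mem_closedBall_self (by positivity))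
  have hFx : X.indicator F x = r.toFun x := by
    rw [Set.indicator_of_mem x.2]
    exact congrFun hF x
  rw [hFx] at hlim
  -- Once the ball lies inside the open set, averages in `X` and in `ℝ^d` coincide.
  have hsub : ∀ᶠ n : ℕ in atTop,
      Metric.closedBall (x : EuclideanSpace ℝ (Fin d)) (1 / ((n : ℝ) + 1)) ⊆ X := by
    obtain ⟨ε, hε, hball⟩ := Metric.isOpen_iff.1 hX x x.2
    filter_upwards [(tendsto_nhds_of_tendsto_nhdsWithin hδ).eventually (gt_mem_nhds hε)] with n hn
    exact (Metric.closedBall_subset_ball hn).trans hball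
  refine (hlim.congr' ?_).limsup_eq
  filter_upwards [hsub] with n hn
  have hpre : (Subtype.val : X → EuclideanSpace ℝ (Fin d)) ⁻¹'
      Metric.closedBall (x : EuclideanSpace ℝ (Fin d)) (1 / ((n : ℝ) + 1))
      = Metric.closedBall x (1 / ((n : ℝ) + 1)) := rfl
  have hres : (volume.restrict X).restrict
      (Metric.closedBall (x : EuclideanSpace ℝ (Fin d)) (1 / ((n : ℝ) + 1)))
      = volume.restrict (Metric.closedBall (x : EuclideanSpace ℝ (Fin d)) (1 / ((n : ℝ) + 1))) :=
    Measure.restrict_restrict_of_subset hn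
  rw [setAverage_eq, setAverage_eq, ← hres, ← map_lebesgueOn hX, hemb.setIntegral_map, hpre]
  congr 1
  · rw [measureReal_def, measureReal_def, lebesgueOn_apply hX, ← hpre,
      Subtype.image_preimage_coe, Set.inter_eq_right.2 hn]
  · refine setIntegral_congr_fun Metric.isClosed_closedBall.measurableSet fun y _ => ?_
    rw [Set.indicator_of_mem y.2]
    exact congrFun hF y

end Lebesgue

/-! ### Finite mixtures of extremal mechanisms -/

section Mixture

variable {d : ℕ} {X : Set (EuclideanSpace ℝ (Fin d))} {α : ℝ} {ι : Type} [Fintype ι]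

/-- The finitely supported measure with masses `w i` at the points `r i`. -/
noncomputable def discreteMeasure {Y : Type} [MeasurableSpace Y] (w : ι → ℝ) (r : ι → Y) :
    Measure Y :=
  ∑ i, ENNReal.ofReal (w i) • Measure.dirac (r i)

theorem integral_discreteMeasure {Y : Type} [MeasurableSpace Y] {w : ι → ℝ} (hw : ∀ i, 0 ≤ w i)
    (r : ι → Y) {f : Y → ℝ} (hf : Measurable f) :
    ∫ y, f y ∂(discreteMeasure w r) = ∑ i, w i * f (r i) := by
  rw [discreteMeasure, integral_finsetSum_measure fun i _ =>
    (integrable_dirac' hf.stronglyMeasurable enorm_lt_top).smul_measure ENNReal.ofReal_ne_top]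
  refine Finset.sum_congr rfl fun i _ => ?_
  rw [integral_smul_measure, integral_dirac' _ _ hf.stronglyMeasurable,
    ENNReal.toReal_ofReal (hw i), smul_eq_mul]

theorem innerRegular_discreteMeasure {Y : Type} [MeasurableSpace Y] [TopologicalSpace Y]
    (w : ι → ℝ) (r : ι → Y) : (discreteMeasure w r).InnerRegular := by
  refine ⟨fun U hU c hc => ⟨U ∩ Set.range r, Set.inter_subset_left,
    ((Set.finite_range r).subset Set.inter_subset_right).isCompact, hc.trans_le ?_⟩⟩
  simp only [discreteMeasure, Measure.finsetSum_apply, Measure.smul_apply, smul_eq_mul]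
  refine Finset.sum_le_sum fun i _ => mul_le_mul_right ?_ _
  rw [Measure.dirac_apply' _ hU]
  refine le_trans (le_of_eq ?_) Measure.le_dirac_apply
  by_cases h : r i ∈ U <;> simp [h]

theorem isStairNormalized_discreteMeasure (hX : IsOpen X) [Nonempty X] {w : ι → ℝ}
    (hw : ∀ i, 0 ≤ w i) (r : ι → stairExtremal (lebesgueOn X) α)
    (hsum : ∀ᵐ x ∂(lebesgueOn X), ∑ i, w i * (r i).1.toFun x = 1) :
    IsStairNormalized (discreteMeasure w r) where
  subprob := by
    have hne : (ae (lebesgueOn X)).NeBot := ae_lebesgueOn_neBot hX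
    -- Since `r_i ≥ 1`, the total mass is at most `∑ w_i r_i(x) = 1` at any one good point `x`.
    obtain ⟨x, hx, hx'⟩ := (hsum.and (ae_all_iff.2 fun i => (r i).1.bounds)).exists
    simp only [discreteMeasure, Measure.finsetSum_apply, Measure.smul_apply, smul_eq_mul,
      measure_univ, mul_one]
    rw [← ENNReal.ofReal_sum_of_nonneg fun i _ => hw i, ENNReal.ofReal_le_one, ← hx]
    exact Finset.sum_le_sum fun i _ => le_mul_of_one_le_right (hw i) (hx' i).1
  radon := innerRegular_discreteMeasure w r
  normalized := by
    filter_upwards [hsum, ae_all_iff.2 fun i => stairEval_ae hX (r i).1] with x hx hx'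
    rw [integral_discreteMeasure hw r
      (f := fun r : stairExtremal (lebesgueOn X) α => stairEval x r.1)
      ((measurable_stairEval hX x).comp measurable_subtype_coe), ← hx]
    exact Finset.sum_congr rfl fun i _ => by rw [hx' i]

/-- The point of the cube `[0, 1]^K` as a mixture of the vertices of the cube. -/
theorem exists_vertex_weights {K : Type} [Fintype K] [DecidableEq K] (u : K → ℝ)
    (hu : ∀ k, 0 ≤ u k ∧ u k ≤ 1) :
    ∃ W : Finset K → ℝ, (∀ S, 0 ≤ W S) ∧ ∑ S, W S = 1 ∧
      ∀ k, ∑ S, W S * (if k ∈ S then 1 else 0) = u k := by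
  -- `W S` is the law of a random subset containing each `k` independently with probability `u k`.
  -- For the marginal at `k₀`, the product is expanded with `1 - u k₀` replaced by `0`, which kills
  -- the sets missing `k₀`.
  refine ⟨fun S => (∏ k ∈ S, u k) * ∏ k ∈ Finset.univ \ S, (1 - u k), fun S => ?_, ?_, fun k₀ => ?_⟩
  · exact mul_nonneg (Finset.prod_nonneg fun k _ => (hu k).1)
      (Finset.prod_nonneg fun k _ => sub_nonneg.2 (hu k).2)
  · have := Finset.prod_add u (fun k => 1 - u k) Finset.univ
    simpa using this.symm
  · have h := Finset.prod_add u (fun k => if k = k₀ then 0 else 1 - u k) Finset.univ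
    rw [Finset.powerset_univ] at h
    have hl : ∏ k, (u k + if k = k₀ then 0 else 1 - u k) = u k₀ := by
      rw [Finset.prod_eq_single k₀ (fun k _ hk => by simp [hk]) (by simp)]
      simp
    rw [← hl, h]
    refine Finset.sum_congr rfl fun S _ => ?_
    by_cases hS : k₀ ∈ S
    · rw [if_pos hS, mul_one]
      refine congrArg _ (Finset.prod_congr rfl fun k hk => ?_)
      have : k ≠ k₀ := by
        rintro rfl
        exact (Finset.mem_sdiff.1 hk).2 hS
      rw [if_neg this]
    · rw [if_neg hS, mul_zero, Finset.prod_eq_zero (i := k₀)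
        (Finset.mem_sdiff.2 ⟨Finset.mem_univ _, hS⟩) (by simp), mul_zero]

/-- The convexity of `(a, b) ↦ a² / b`. -/
theorem sq_sum_div_sum_le {w a b : ι → ℝ} (hw : ∀ i, 0 ≤ w i) (hb : ∀ i, 0 < b i)
    (h0 : 0 < ∑ i, w i * b i) :
    (∑ i, w i * a i) ^ 2 / ∑ i, w i * b i ≤ ∑ i, w i * (a i ^ 2 / b i) := by
  rw [div_le_iff₀ h0]
  refine Finset.sum_sq_le_sum_mul_sum_of_sq_le_mul _
    (fun i _ => mul_nonneg (hw i) (div_nonneg (sq_nonneg _) (hb i).le))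
    (fun i _ => mul_nonneg (hw i) (hb i).le) fun i _ => le_of_eq ?_
  have := (hb i).ne'
  field_simp

variable {P₀ : Measure X} [IsProbabilityMeasure P₀] {s : X → ℝ} {I : ℝ}

/-- Each `g j` is a point of the cube `[1, e^α]^K`, hence a mixture of vertices, and the vertices `v
S` are extremal functions shared by all `j`. Giving `v S` the weight `∑ j, c j * W j S` preserves
normalization and, by convexity of `a² / b`, does not decrease the value; the resulting discrete
measure competes in the optimization problem. -/
theorem sum_info_le_of_factorsThrough_finite (hX : IsOpen X) (hα : 0 < α) (hP : P₀ ≪ lebesgueOn X)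
    (hs : Integrable s P₀)
    (hI : ∀ μ' : Measure (stairExtremal (lebesgueOn X) α), IsStairNormalized μ' →
      ∫ r, stairInfo s (modelDensity (lebesgueOn X) P₀) r.1 ∂μ' ≤ I)
    {K : Type} [Finite K] [MeasurableSpace K] [DiscreteMeasurableSpace K] {π : X → K}
    (hπ : Measurable π) {g : ι → K → ℝ} (hg : ∀ j k, 1 ≤ g j k ∧ g j k ≤ Real.exp α)
    {c : ι → ℝ} (hc : ∀ j, 0 ≤ c j) (hsum : ∀ x, ∑ j, c j * g j (π x) = 1) :
    ∑ j, c j * ((∫ x, s x * g j (π x) ∂P₀) ^ 2 / ∫ x, g j (π x) ∂P₀) ≤ I := by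
  classical
  have := Fintype.ofFinite K
  have := sigmaFinite_lebesgueOn hX
  have hne : Nonempty X := nonempty_of_isProbabilityMeasure P₀
  have hexp : 1 < Real.exp α := Real.one_lt_exp_iff.2 hα
  choose W hW0 hW1 hWu using fun j => exists_vertex_weights (fun k => (g j k - 1) / (Real.exp α - 1))
    fun k => ⟨div_nonneg (by linarith [(hg j k).1]) (by linarith),
      (div_le_one (by linarith)).2 (by linarith [(hg j k).2])⟩
  let v : Finset K → X → ℝ := fun S x => if π x ∈ S then Real.exp α else 1
  have hvm : ∀ S, Measurable (v S) := fun S =>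
    Measurable.ite (hπ (MeasurableSet.of_discrete (s := (S : Set K)))) measurable_const
      measurable_const
  have hvb : ∀ S x, 1 ≤ v S x ∧ v S x ≤ Real.exp α := fun S x => by
    by_cases h : π x ∈ S <;> simp [v, h, hexp.le]
  let r : Finset K → stairExtremal (lebesgueOn X) α := fun S =>
    ⟨StairBox.mk' (lebesgueOn X) (v S) (hvm S) (hvb S), by
      change ∀ᵐ x ∂(lebesgueOn X), _
      filter_upwards [StairBox.coeFn_mk' (lam := lebesgueOn X) (v S) (hvm S) (hvb S)] with x hx
      rw [hx]
      by_cases h : π x ∈ S <;> simp [v, h]⟩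
  have hgv : ∀ j x, g j (π x) = ∑ S, W j S * v S x := fun j x => by
    have h : ∀ S, W j S * v S x
        = W j S + (Real.exp α - 1) * (W j S * if π x ∈ S then 1 else 0) := fun S => by
      by_cases h : π x ∈ S
      · simp only [v, h, if_true]; ring
      · simp only [v, h, if_false]; ring
    simp only [h, Finset.sum_add_distrib, ← Finset.mul_sum, hW1, hWu]
    rw [mul_div_cancel₀ _ (by linarith)]
    ring
  have hvi : ∀ S, Integrable (v S) P₀ := fun S =>
    integrable_of_abs_le (hvm S) fun x => by
      rw [abs_of_nonneg (zero_le_one.trans (hvb S x).1)]; exact (hvb S x).2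
  have hsvi : ∀ S, Integrable (fun x => s x * v S x) P₀ := fun S =>
    hs.mul_of_abs_le (hvm S) fun x => by
      rw [abs_of_nonneg (zero_le_one.trans (hvb S x).1)]; exact (hvb S x).2
  have hv1 : ∀ S, 1 ≤ ∫ x, v S x ∂P₀ := fun S =>
    (one_le_integral_and_le (hvm S) (.of_forall (hvb S))).1
  have e1 : ∀ j, ∫ x, g j (π x) ∂P₀ = ∑ S, W j S * ∫ x, v S x ∂P₀ := fun j => by
    simp only [hgv]
    rw [integral_finsetSum _ fun S _ => (hvi S).const_mul _]
    simp only [integral_const_mul]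
  have e2 : ∀ j, ∫ x, s x * g j (π x) ∂P₀ = ∑ S, W j S * ∫ x, s x * v S x ∂P₀ := fun j => by
    simp only [hgv, Finset.mul_sum, mul_left_comm (s _)]
    rw [integral_finsetSum _ fun S _ => (hsvi S).const_mul _]
    simp only [integral_const_mul]
  have hpos : ∀ j, 0 < ∑ S, W j S * ∫ x, v S x ∂P₀ := fun j =>
    calc (0 : ℝ) < ∑ S, W j S := by rw [hW1]; exact one_pos
      _ ≤ _ := Finset.sum_le_sum fun S _ => le_mul_of_one_le_right (hW0 j S) (hv1 S)
  have hw : ∀ S, 0 ≤ ∑ j, c j * W j S := fun S =>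
    Finset.sum_nonneg fun j _ => mul_nonneg (hc j) (hW0 j S)
  have hnorm : IsStairNormalized (discreteMeasure (fun S => ∑ j, c j * W j S) r) := by
    refine isStairNormalized_discreteMeasure hX hw r ?_
    filter_upwards [ae_all_iff.2 fun S =>
      StairBox.coeFn_mk' (lam := lebesgueOn X) (v S) (hvm S) (hvb S)] with x hx
    rw [← hsum x]
    simp only [hgv, r, hx, Finset.mul_sum, Finset.sum_mul]
    rw [Finset.sum_comm]
    simp only [mul_assoc]
  have hle := hI _ hnorm
  rw [integral_discreteMeasure hw r
    (f := fun r : stairExtremal (lebesgueOn X) α =>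
      stairInfo s (modelDensity (lebesgueOn X) P₀) r.1)
    ((continuous_stairInfo hP hs).measurable.comp measurable_subtype_coe)] at hle
  refine le_trans ?_ hle
  have hinfo : ∀ S, stairInfo s (modelDensity (lebesgueOn X) P₀) (r S).1
      = (∫ x, s x * v S x ∂P₀) ^ 2 / ∫ x, v S x ∂P₀ := fun S =>
    stairInfo_mk' hP s (StairBox.coeFn_mk' (v S) (hvm S) (hvb S))
  calc _ ≤ ∑ j, c j * ∑ S, W j S * ((∫ x, s x * v S x ∂P₀) ^ 2 / ∫ x, v S x ∂P₀) := by
        refine Finset.sum_le_sum fun j _ => mul_le_mul_of_nonneg_left ?_ (hc j)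
        rw [e1, e2]
        exact sq_sum_div_sum_le (hW0 j) (fun S => zero_lt_one.trans_le (hv1 S)) (hpos j)
    _ = _ := by
        simp only [hinfo, Finset.mul_sum, Finset.sum_mul]
        rw [Finset.sum_comm]
        simp only [mul_assoc]

/-- The value of a mixture of finitely many functions of the box is at most the optimal value of
the optimization problem. -/
theorem sum_info_le (hX : IsOpen X) (hα : 0 < α) (hP : P₀ ≪ lebesgueOn X)
    (hs : Integrable s P₀)
    (hI : ∀ μ' : Measure (stairExtremal (lebesgueOn X) α), IsStairNormalized μ' →
      ∫ r, stairInfo s (modelDensity (lebesgueOn X) P₀) r.1 ∂μ' ≤ I)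
    {r : ι → X → ℝ} (hr : ∀ j, Measurable (r j)) (hrb : ∀ j x, 1 ≤ r j x ∧ r j x ≤ Real.exp α)
    {c : ι → ℝ} (hc : ∀ j, 0 ≤ c j) (hsum : ∀ x, ∑ j, c j * r j x = 1) :
    ∑ j, c j * ((∫ x, s x * r j x ∂P₀) ^ 2 / ∫ x, r j x ∂P₀) ≤ I := by
  have hne : Nonempty X := nonempty_of_isProbabilityMeasure P₀
  have habs : ∀ j x, |r j x| ≤ Real.exp α := fun j x => by
    rw [abs_of_nonneg (zero_le_one.trans (hrb j x).1)]; exact (hrb j x).2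
  -- The finite label of `x` records all `r j x` up to precision `1 / (n + 1)`.
  let N : ℕ → ℕ := fun n => ⌊((n : ℝ) + 1) * Real.exp α⌋₊ + 1
  let π : (n : ℕ) → X → ι → Fin (N n) := fun n x j =>
    ⟨⌊((n : ℝ) + 1) * r j x⌋₊, Nat.lt_succ_of_le (Nat.floor_le_floor
      (mul_le_mul_of_nonneg_left (hrb j x).2 (by positivity)))⟩
  have hπ : ∀ n, Measurable (π n) := fun n => by
    refine measurable_pi_lambda _ fun j => ?_
    refine measurable_to_countable' fun k => ?_
    have h : (fun x => π n x j) ⁻¹' {k} = (fun x => ⌊((n : ℝ) + 1) * r j x⌋₊) ⁻¹' {(k : ℕ)} := by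
      ext x
      simp [π, Fin.ext_iff]
    rw [h]
    exact Nat.measurable_floor.comp ((hr j).const_mul _) (measurableSet_singleton _)
  -- One point of `X` is chosen in each cell. Evaluating `r j` at chosen points, instead of rounding
  -- its values, keeps both the bounds and the constraint `∑ c j * r j = 1` exact.
  let σ : (n : ℕ) → X → X := fun n x => Function.invFun (π n) (π n x)
  have hσ : ∀ n x, π n (σ n x) = π n x := fun n x => Function.invFun_eq ⟨x, rfl⟩
  have hclose : ∀ n j x, |r j (σ n x) - r j x| ≤ 1 / ((n : ℝ) + 1) := fun n j x => by
    have h : ⌊((n : ℝ) + 1) * r j (σ n x)⌋₊ = ⌊((n : ℝ) + 1) * r j x⌋₊ :=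
      congrArg Fin.val (congrFun (hσ n x) j)
    have hn : (0 : ℝ) < (n : ℝ) + 1 := by positivity
    have h0 : ∀ y, 0 ≤ ((n : ℝ) + 1) * r j y := fun y =>
      mul_nonneg hn.le (zero_le_one.trans (hrb j y).1)
    have a1 := Nat.floor_le (h0 (σ n x))
    have a2 := Nat.lt_floor_add_one (((n : ℝ) + 1) * r j (σ n x))
    have b1 := Nat.floor_le (h0 x)
    have b2 := Nat.lt_floor_add_one (((n : ℝ) + 1) * r j x)
    rw [h] at a1 a2
    rw [abs_le, neg_le, le_div_iff₀ hn, le_div_iff₀ hn]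
    constructor <;> linarith
  have hlim : ∀ j x, Tendsto (fun n => r j (σ n x)) atTop (𝓝 (r j x)) := fun j x => by
    rw [tendsto_iff_dist_tendsto_zero]
    exact squeeze_zero (fun _ => dist_nonneg) (fun n => hclose n j x)
      tendsto_one_div_add_atTop_nhds_zero_nat
  -- No measurability of `σ n` is needed: the composite is a function of the finite label.
  have hσm : ∀ n j, Measurable fun x => r j (σ n x) := fun n j =>
    (Measurable.of_discrete (f := fun k => r j (Function.invFun (π n) k))).comp (hπ n)
  have l1 : ∀ j, Tendsto (fun n => ∫ x, r j (σ n x) ∂P₀) atTop (𝓝 (∫ x, r j x ∂P₀)) := fun j =>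
    tendsto_integral_of_dominated_convergence (fun _ => Real.exp α)
      (fun n => (hσm n j).aestronglyMeasurable) (integrable_const _)
      (fun n => .of_forall fun x => habs j _) (.of_forall (hlim j))
  have l2 : ∀ j, Tendsto (fun n => ∫ x, s x * r j (σ n x) ∂P₀) atTop
      (𝓝 (∫ x, s x * r j x ∂P₀)) := fun j =>
    tendsto_integral_of_dominated_convergence (fun x => |s x| * Real.exp α)
      (fun n => hs.aestronglyMeasurable.mul (hσm n j).aestronglyMeasurable)
      (hs.abs.mul_const _)
      (fun n => .of_forall fun x => by
        rw [norm_mul]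
        exact mul_le_mul_of_nonneg_left (habs j _) (abs_nonneg _))
      (.of_forall fun x => (hlim j x).const_mul _)
  refine le_of_tendsto (tendsto_finsetSum _ fun j _ =>
    (((l2 j).pow 2).div (l1 j) ?_).const_mul (c j)) (.of_forall fun n => ?_)
  · exact (zero_lt_one.trans_le (one_le_integral_and_le (hr j) (.of_forall (hrb j))).1).ne'
  · exact sum_info_le_of_factorsThrough_finite hX hα hP hs hI (hπ n)
      (g := fun j k => r j (Function.invFun (π n) k)) (fun j k => hrb j _) hc fun x => hsum _

end Mixture

/-! ### Private mechanisms are no better than staircase mechanisms -/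

section UpperBound

variable {𝒳 Z : Type} [MeasurableSpace 𝒳] [MeasurableSpace Z]

theorem measurable_kernel_real (Q : Kernel 𝒳 Z) {A : Set Z} (hA : MeasurableSet A) :
    Measurable fun x => (Q x).real A :=
  (Q.measurable_coe hA).ennreal_toReal

theorem integral_indicator_bind (P : Measure 𝒳) (Q : Kernel 𝒳 Z) [IsMarkovKernel Q] {A : Set Z}
    (hA : MeasurableSet A) :
    ∫ z, A.indicator (fun _ => (1 : ℝ)) z ∂(P.bind Q) = ∫ x, (Q x).real A ∂P := by
  rw [integral_indicator hA, setIntegral_const, smul_eq_mul, mul_one, measureReal_def,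
    Measure.bind_apply hA Q.measurable.aemeasurable]
  exact (integral_toReal (Q.measurable_coe hA).aemeasurable
    (.of_forall fun x => measure_lt_top _ _)).symm

/-- The score of the privatized model is the conditional expectation of the score. -/
theorem IsDQMScore.setIntegral_bind {lam : Measure 𝒳} [SigmaFinite lam] {P : ℝ → Measure 𝒳}
    {θ₀ : ℝ} {s : 𝒳 → ℝ} (hs : IsDQMScore lam P θ₀ s)
    (hP : ∀ᶠ θ in 𝓝 θ₀, IsProbabilityMeasure (P θ) ∧ P θ ≪ lam) {Q : Kernel 𝒳 Z}
    [IsMarkovKernel Q] {ν : Measure Z} [SigmaFinite ν] {t : Z → ℝ}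
    (ht : IsDQMScore ν (fun θ => (P θ).bind Q) θ₀ t)
    (hPQ : ∀ᶠ θ in 𝓝 θ₀, IsProbabilityMeasure ((P θ).bind Q) ∧ (P θ).bind Q ≪ ν) {A : Set Z}
    (hA : MeasurableSet A) :
    ∫ z in A, t z ∂((P θ₀).bind Q) = ∫ x, s x * (Q x).real A ∂P θ₀ := by
  -- Both sides are the derivative at `θ₀` of the probability of `A` under the privatized law.
  have h1 := ht.hasDerivAt_integral hPQ (g := A.indicator fun _ => (1 : ℝ))
    (measurable_const.indicator hA) (C := 1) fun z => by
      by_cases h : z ∈ A <;> simp [h]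
  have h2 := hs.hasDerivAt_integral hP (g := fun x => (Q x).real A) (measurable_kernel_real Q hA)
    (C := 1) fun x => by rw [abs_of_nonneg measureReal_nonneg]; exact measureReal_le_one
  simp only [integral_indicator_bind _ Q hA] at h1
  rw [← h1.unique h2, ← integral_indicator hA]
  refine integral_congr_ae (.of_forall fun z => ?_)
  by_cases h : z ∈ A <;> simp [h]

variable {d : ℕ} {X : Set (EuclideanSpace ℝ (Fin d))} {α : ℝ} {P₀ : Measure X}
  [IsProbabilityMeasure P₀] {s : X → ℝ} {I : ℝ}

/-- The value of a private mechanism with finitely many outcomes `Z_j`, in the form of a lower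
bound of `∑_j (E[s Q(Z_j|x)])² / E[Q(Z_j|x)]`. -/
theorem sum_quadratic_le {ι : Type} [Fintype ι] (hX : IsOpen X) (hα : 0 < α)
    (hP : P₀ ≪ lebesgueOn X) (hs : Integrable s P₀)
    (hI : ∀ μ' : Measure (stairExtremal (lebesgueOn X) α), IsStairNormalized μ' →
      ∫ r, stairInfo s (modelDensity (lebesgueOn X) P₀) r.1 ∂μ' ≤ I)
    {q : ι → X → ℝ} (hq : ∀ j, Measurable (q j)) (hq0 : ∀ j x, 0 ≤ q j x)
    (hqα : ∀ j x x', q j x ≤ Real.exp α * q j x') (hsum : ∀ x, ∑ j, q j x = 1) (v : ι → ℝ) :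
    ∑ j, (2 * v j * ∫ x, s x * q j x ∂P₀ - v j ^ 2 * ∫ x, q j x ∂P₀) ≤ I := by
  have hne : Nonempty X := nonempty_of_isProbabilityMeasure P₀
  have hexp : 1 ≤ Real.exp α := Real.one_le_exp hα.le
  -- Privacy gives `c j ≤ q j x ≤ e^α * c j`, so `q j / c j` lies in the box whenever `c j ≠ 0`.
  let c : ι → ℝ := fun j => ⨅ x, q j x
  have hbdd : ∀ j, BddBelow (Set.range (q j)) := fun j => ⟨0, by rintro _ ⟨x, rfl⟩; exact hq0 j x⟩
  have hc0 : ∀ j, 0 ≤ c j := fun j => le_ciInf (hq0 j)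
  have hcq : ∀ j x, c j ≤ q j x := fun j x => ciInf_le (hbdd j) x
  have hqc : ∀ j x, q j x ≤ Real.exp α * c j := fun j x => by
    have : q j x / Real.exp α ≤ c j := le_ciInf fun x' => by
      rw [div_le_iff₀ (by linarith), mul_comm]
      exact hqα j x x'
    rwa [div_le_iff₀ (by linarith), mul_comm] at this
  let r : ι → X → ℝ := fun j x => if c j = 0 then 1 else q j x / c j
  have hcr : ∀ j x, c j * r j x = q j x := fun j x => by
    by_cases h : c j = 0
    · have h1 := hqc j x
      rw [h, mul_zero] at h1
      rw [h, zero_mul, le_antisymm h1 (hq0 j x)]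
    · simp only [r, h, if_false]
      rw [mul_div_cancel₀ _ h]
  have hrm : ∀ j, Measurable (r j) := fun j => by
    by_cases h : c j = 0
    · simp only [r, h, if_true]; exact measurable_const
    · simp only [r, h, if_false]; exact (hq j).div_const _
  have hrb : ∀ j x, 1 ≤ r j x ∧ r j x ≤ Real.exp α := fun j x => by
    by_cases h : c j = 0
    · simp only [r, h, if_true]; exact ⟨le_rfl, hexp⟩
    · have hpos : 0 < c j := lt_of_le_of_ne (hc0 j) (Ne.symm h)
      simp only [r, h, if_false]
      exact ⟨(one_le_div hpos).2 (hcq j x), (div_le_iff₀ hpos).2 (hqc j x)⟩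
  refine le_trans (Finset.sum_le_sum fun j _ => ?_)
    (sum_info_le hX hα hP hs hI hrm hrb hc0 fun x => by simp only [hcr]; exact hsum x)
  have e1 : ∫ x, q j x ∂P₀ = c j * ∫ x, r j x ∂P₀ := by
    rw [← integral_const_mul]; simp only [hcr]
  have e2 : ∫ x, s x * q j x ∂P₀ = c j * ∫ x, s x * r j x ∂P₀ := by
    rw [← integral_const_mul]; simp only [mul_left_comm (c j), hcr]
  have h1 := (one_le_integral_and_le (P₀ := P₀) (hrm j) (.of_forall (hrb j))).1
  rw [e1, e2]
  generalize ∫ x, r j x ∂P₀ = b at *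
  generalize ∫ x, s x * r j x ∂P₀ = a at *
  -- Completing the square. The form linear in `q j` on the left needs no division by `E[q j]`,
  -- which may be zero.
  have : 2 * v j * a - v j ^ 2 * b ≤ a ^ 2 / b := by
    rw [le_div_iff₀ (by linarith)]
    nlinarith [sq_nonneg (a - v j * b)]
  calc _ = c j * (2 * v j * a - v j ^ 2 * b) := by ring
    _ ≤ _ := mul_le_mul_of_nonneg_left this (hc0 j)

/-- The second moment is the supremum of `∫ (2 g t - g²)` over the simple functions `g`. -/
theorem integral_sq_le_of_simpleFunc {m : Measure Z} [IsProbabilityMeasure m] {t : Z → ℝ}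
    (hLp : MemLp t 2 m) (h : ∀ g : SimpleFunc Z ℝ, ∫ z, (2 * g z * t z - g z ^ 2) ∂m ≤ I) :
    ∫ z, t z ^ 2 ∂m ≤ I := by
  have ht2 : Integrable (fun z => t z ^ 2) m := hLp.integrable_sq
  refine le_of_forall_pos_le_add fun ε hε => ?_
  obtain ⟨g, hg, hgL⟩ := hLp.exists_simpleFunc_eLpNorm_sub_lt (by simp)
    (ε := ENNReal.ofReal (√ε)) (by simpa using hε)
  have hsub : MemLp (t - ⇑g) 2 m := hLp.sub hgL
  have hsq : Integrable (fun z => (t z - g z) ^ 2) m :=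
    (memLp_two_iff_integrable_sq hsub.1).1 hsub
  have hsmall : ∫ z, (t z - g z) ^ 2 ∂m ≤ ε := by
    have h1 := hsub.eLpNorm_eq_integral_rpow_norm two_ne_zero (by simp)
    rw [h1] at hg
    have h2 := (ENNReal.ofReal_lt_ofReal_iff (Real.sqrt_pos.2 hε)).1 hg
    have h3 : ∫ z, ‖(t - ⇑g) z‖ ^ (2 : ENNReal).toReal ∂m = ∫ z, (t z - g z) ^ 2 ∂m :=
      integral_congr_ae (.of_forall fun z => by simp)
    rw [h3] at h2
    have h4 : 0 ≤ ∫ z, (t z - g z) ^ 2 ∂m := integral_nonneg fun z => sq_nonneg _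
    have h5 : √(∫ z, (t z - g z) ^ 2 ∂m) < √ε := by
      rw [Real.sqrt_eq_rpow]
      simpa using h2
    exact ((Real.sqrt_lt_sqrt_iff h4).1 h5).le
  calc ∫ z, t z ^ 2 ∂m = ∫ z, ((2 * g z * t z - g z ^ 2) + (t z - g z) ^ 2) ∂m :=
        integral_congr_ae (.of_forall fun z => by ring)
    _ = ∫ z, (2 * g z * t z - g z ^ 2) ∂m + ∫ z, (t z - g z) ^ 2 ∂m := by
        refine integral_add ?_ hsq
        refine (ht2.sub hsq).congr (.of_forall fun z => ?_)
        simp only [Pi.sub_apply]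
        ring
    _ ≤ I + ε := add_le_add (h g) hsmall


/-- On each fiber of `g` the integrand is affine in `t`, so only the probabilities and score
integrals of the fibers enter. The fibers reduce `Q` to a private mechanism with finitely many
outcomes, to which `sum_quadratic_le` applies. -/
theorem integral_simpleFunc_score_le (hX : IsOpen X) (hα : 0 < α) {P : ℝ → Measure X} {θ₀ : ℝ}
    (hs : IsDQMScore (lebesgueOn X) P θ₀ s)
    (hP : ∀ᶠ θ in 𝓝 θ₀, IsProbabilityMeasure (P θ) ∧ P θ ≪ lebesgueOn X)
    (hI : ∀ μ' : Measure (stairExtremal (lebesgueOn X) α), IsStairNormalized μ' →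
      ∫ r, stairInfo s (modelDensity (lebesgueOn X) (P θ₀)) r.1 ∂μ' ≤ I)
    {Q : Kernel X Z} [IsMarkovKernel Q] (hQ : IsLDP α Q) {ν : Measure Z} [SigmaFinite ν]
    {t : Z → ℝ} (ht : IsDQMScore ν (fun θ => (P θ).bind Q) θ₀ t)
    (hPQ' : ∀ᶠ θ in 𝓝 θ₀, IsProbabilityMeasure ((P θ).bind Q) ∧ (P θ).bind Q ≪ ν)
    (g : SimpleFunc Z ℝ) :
    ∫ z, (2 * g z * t z - g z ^ 2) ∂((P θ₀).bind Q) ≤ I := by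
  have := sigmaFinite_lebesgueOn hX
  have := hP.self_of_nhds.1
  set m := (P θ₀).bind Q with hm
  have hmp : IsProbabilityMeasure m := hPQ'.self_of_nhds.1
  have ht1 : Integrable t m := ht.integrable hPQ'
  let A : g.range → Set Z := fun v => g ⁻¹' {v.1}
  have hA : ∀ v, MeasurableSet (A v) := fun v => g.measurableSet_fiber v.1
  have hpt : ∀ z, 2 * g z * t z - g z ^ 2
      = ∑ v : g.range, (A v).indicator (fun z => 2 * v.1 * t z - v.1 ^ 2) z := fun z => by
    rw [Finset.sum_eq_single ⟨g z, g.mem_range_self z⟩]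
    · rw [Set.indicator_of_mem (by simp [A])]
    · intro v _ hv
      refine Set.indicator_of_notMem (fun h => hv (Subtype.ext ?_)) _
      exact (Set.mem_singleton_iff.1 h).symm
    · simp
  have hint : ∀ v : g.range, Integrable (fun z => 2 * v.1 * t z - v.1 ^ 2) m := fun v =>
    (ht1.const_mul _).sub (integrable_const _)
  have hterm : ∀ v : g.range, ∫ z, (A v).indicator (fun z => 2 * v.1 * t z - v.1 ^ 2) z ∂m
      = 2 * v.1 * ∫ x, s x * (Q x).real (A v) ∂P θ₀ - v.1 ^ 2 * ∫ x, (Q x).real (A v) ∂P θ₀ :=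
    fun v => by
      rw [integral_indicator (hA v), integral_sub (ht1.integrableOn.const_mul _)
        (integrable_const _), integral_const_mul, hs.setIntegral_bind hP ht hPQ' (hA v),
        ← integral_indicator_bind _ Q (hA v), integral_indicator (hA v), setIntegral_const,
        setIntegral_const]
      simp only [smul_eq_mul, mul_one, ← hm]
      ring
  simp only [hpt]
  rw [integral_finsetSum _ fun v _ => (hint v).indicator (hA v)]
  simp only [hterm]
  refine sum_quadratic_le hX hα hP.self_of_nhds.2 (hs.integrable hP) hI
    (q := fun v x => (Q x).real (A v)) (fun v => measurable_kernel_real Q (hA v))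
    (fun v x => measureReal_nonneg) (fun v x x' => ?_) (fun x => ?_) fun v => v.1
  · have := ENNReal.toReal_mono (ENNReal.mul_ne_top ENNReal.ofReal_ne_top (measure_ne_top _ _))
      (hQ x x' (A v) (hA v))
    rwa [ENNReal.toReal_mul, ENNReal.toReal_ofReal (Real.exp_nonneg _)] at this
  · have h := sum_measureReal_preimage_singleton (μ := Q x) g.range
      (fun v _ => g.measurableSet_fiber v)
    rw [Finset.sum_coe_sort g.range fun v => (Q x).real (g ⁻¹' {v}), h]
    have : g ⁻¹' (g.range : Set ℝ) = Set.univ := by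
      rw [SimpleFunc.coe_range, Set.preimage_range]
    rw [this, probReal_univ]

/-- The Fisher information of a privatized model is at most the optimal value of the
optimization problem. -/
theorem fisherInfo_bind_le (hX : IsOpen X) (hα : 0 < α) {P : ℝ → Measure X} {θ₀ : ℝ}
    (hs : IsDQMScore (lebesgueOn X) P θ₀ s)
    (hP : ∀ᶠ θ in 𝓝 θ₀, IsProbabilityMeasure (P θ) ∧ P θ ≪ lebesgueOn X)
    (hI : ∀ μ' : Measure (stairExtremal (lebesgueOn X) α), IsStairNormalized μ' →
      ∫ r, stairInfo s (modelDensity (lebesgueOn X) (P θ₀)) r.1 ∂μ' ≤ I)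
    {Q : Kernel X Z} [IsMarkovKernel Q] (hQ : IsLDP α Q) {ν : Measure Z} [SigmaFinite ν]
    {t : Z → ℝ} (ht : IsDQMScore ν (fun θ => (P θ).bind Q) θ₀ t)
    (hPQ : ∀ᶠ θ in 𝓝 θ₀, (P θ).bind Q ≪ ν) :
    ∫ z, t z ^ 2 ∂((P θ₀).bind Q) ≤ I := by
  have := sigmaFinite_lebesgueOn hX
  have := hP.self_of_nhds.1
  have hPQ' : ∀ᶠ θ in 𝓝 θ₀, IsProbabilityMeasure ((P θ).bind Q) ∧ (P θ).bind Q ≪ ν := by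
    filter_upwards [hP, hPQ] with θ h1 h2
    have := h1.1
    exact ⟨inferInstance, h2⟩
  have := hPQ'.self_of_nhds.1
  exact integral_sq_le_of_simpleFunc
    ((memLp_two_iff_integrable_sq ht.1.aestronglyMeasurable).2 (ht.integrable_sq hPQ'))
    (integral_simpleFunc_score_le hX hα hs hP hI hQ ht hPQ')

end UpperBound

/-! ### The binary mechanism of an element of the box -/

section Binary

variable {𝒳 : Type} [MeasurableSpace 𝒳] {lam : Measure 𝒳} {α : ℝ}

/-- The two functions are a representative of `r` and its mirror image; they add up to `e^α + 1`,
which dictates the weights. The pair serves twice: as a mixture bounded by the optimal value and as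
the density of a private kernel on `Bool`. -/
theorem exists_binary_split [SigmaFinite lam] {P₀ : Measure 𝒳} [IsProbabilityMeasure P₀]
    (hα : 0 < α) (hP : P₀ ≪ lam) (s : 𝒳 → ℝ) (r : StairBox lam α) :
    ∃ U : Bool → 𝒳 → ℝ, (∀ b, Measurable (U b)) ∧ (∀ b x, 1 ≤ U b x ∧ U b x ≤ Real.exp α) ∧
      (∀ x, ∑ b, 1 / (Real.exp α + 1) * U b x = 1) ∧
      ∑ b, 1 / (Real.exp α + 1) * ((∫ x, s x * U b x ∂P₀) ^ 2 / ∫ x, U b x ∂P₀)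
        = 2 / (Real.exp α + 1) * stairInfoSym s (modelDensity lam P₀) r := by
  obtain ⟨u, hu, hub, hru⟩ := r.exists_representative hα
  have hexp := Real.exp_pos α
  have hswap : (stairSwap r).toFun =ᵐ[lam] fun x => Real.exp α + 1 - u x := by
    filter_upwards [stairSwap_ae r, hru] with x h1 h2
    rw [h1, h2]
  refine ⟨fun b => bif b then u else fun x => Real.exp α + 1 - u x, fun b => ?_, fun b x => ?_,
    fun x => ?_, ?_⟩
  · cases b
    · exact hu.const_sub _
    · exact hu
  · have := hub x
    cases b
    · constructor <;> simp only [cond_false] <;> linarith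
    · exact this
  · simp only [Fintype.sum_bool, cond_true, cond_false]
    field_simp
    ring
  · simp only [Fintype.sum_bool, cond_true, cond_false]
    rw [← stairInfo_mk' hP s hru, ← stairInfo_mk' hP s hswap, stairInfoSym]
    ring

/-- The uniform measure on the two outcomes, of mass `2 / (e^α + 1)`. -/
noncomputable def binaryBase (α : ℝ) : Measure Bool :=
  discreteMeasure (fun _ : Bool => 1 / (Real.exp α + 1)) id

instance : IsFiniteMeasure (binaryBase α) := by
  refine ⟨?_⟩
  simp [binaryBase, discreteMeasure]

theorem integral_binaryBase (f : Bool → ℝ) :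
    ∫ b, f b ∂(binaryBase α) = ∑ b, 1 / (Real.exp α + 1) * f b :=
  integral_discreteMeasure (fun _ => by positivity) id (Measurable.of_discrete)

/-- The mechanism with two outcomes and densities `U b`. -/
noncomputable def binaryKernel (α : ℝ) (U : Bool → 𝒳 → ℝ) : Kernel 𝒳 Bool :=
  (Kernel.const 𝒳 (binaryBase α)).withDensity fun x b => ENNReal.ofReal (U b x)

theorem measurable_uncurry_ofReal {U : Bool → 𝒳 → ℝ} (hU : ∀ b, Measurable (U b)) :
    Measurable (Function.uncurry fun x b => ENNReal.ofReal (U b x)) :=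
  measurable_from_prod_countable_left fun b => (hU b).ennreal_ofReal

theorem binaryKernel_apply {U : Bool → 𝒳 → ℝ} (hU : ∀ b, Measurable (U b)) (x : 𝒳) (A : Set Bool) :
    binaryKernel α U x A = ∫⁻ b in A, ENNReal.ofReal (U b x) ∂(binaryBase α) := by
  rw [binaryKernel, Kernel.withDensity_apply' _ (measurable_uncurry_ofReal hU), Kernel.const_apply]

theorem isMarkovKernel_binaryKernel {U : Bool → 𝒳 → ℝ} (hU : ∀ b, Measurable (U b))
    (hUb : ∀ b x, 1 ≤ U b x ∧ U b x ≤ Real.exp α)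
    (hsum : ∀ x, ∑ b, 1 / (Real.exp α + 1) * U b x = 1) : IsMarkovKernel (binaryKernel α U) := by
  refine ⟨fun x => ⟨?_⟩⟩
  rw [binaryKernel_apply hU, Measure.restrict_univ,
    ← ofReal_integral_eq_lintegral_ofReal (Integrable.of_finite)
      (.of_forall fun b => zero_le_one.trans (hUb b x).1), integral_binaryBase, hsum,
    ENNReal.ofReal_one]

theorem isLDP_binaryKernel {U : Bool → 𝒳 → ℝ} (hU : ∀ b, Measurable (U b))
    (hUb : ∀ b x, 1 ≤ U b x ∧ U b x ≤ Real.exp α) : IsLDP α (binaryKernel α U) := by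
  intro x x' A _
  rw [binaryKernel_apply hU, binaryKernel_apply hU,
    ← lintegral_const_mul' _ _ ENNReal.ofReal_ne_top]
  refine lintegral_mono fun b => ?_
  simp only
  rw [← ENNReal.ofReal_mul (Real.exp_nonneg _)]
  exact ENNReal.ofReal_le_ofReal ((hUb b x).2.trans
    (le_mul_of_one_le_right (Real.exp_nonneg _) (hUb b x').1))

theorem bind_binaryKernel {U : Bool → 𝒳 → ℝ} (hU : ∀ b, Measurable (U b))
    (hUb : ∀ b x, 1 ≤ U b x ∧ U b x ≤ Real.exp α) (P : Measure 𝒳) [IsProbabilityMeasure P] :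
    P.bind (binaryKernel α U)
      = (binaryBase α).withDensity fun b => ENNReal.ofReal (∫ x, U b x ∂P) := by
  ext A hA
  rw [Measure.bind_apply hA (Kernel.measurable _).aemeasurable, withDensity_apply _ hA]
  simp only [binaryKernel_apply hU]
  rw [lintegral_lintegral_swap (measurable_uncurry_ofReal hU).aemeasurable]
  refine lintegral_congr fun b => ?_
  refine (ofReal_integral_eq_lintegral_ofReal (integrable_of_abs_le (hU b) (C := Real.exp α)
    fun x => ?_) (.of_forall fun x => zero_le_one.trans (hUb b x).1)).symm
  rw [abs_of_nonneg (zero_le_one.trans (hUb b x).1)]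
  exact (hUb b x).2

end Binary

/-! ### The main theorem -/

section Main

variable {𝒳 : Type} [MeasurableSpace 𝒳] {lam : Measure 𝒳} {α : ℝ}

theorem eventually_isProbabilityMeasure {Θ : Set ℝ} {θ₀ : ℝ} (hθ₀ : θ₀ ∈ interior Θ)
    {P : ℝ → Measure 𝒳} (hP : ∀ θ ∈ Θ, IsProbabilityMeasure (P θ)) (hPdom : ∀ θ ∈ Θ, P θ ≪ lam) :
    ∀ᶠ θ in 𝓝 θ₀, IsProbabilityMeasure (P θ) ∧ P θ ≪ lam := by
  filter_upwards [mem_interior_iff_mem_nhds.1 hθ₀] with θ hθ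
  exact ⟨hP θ hθ, hPdom θ hθ⟩

/-- The value of the binary mechanism of an element of the box is a private Fisher information. -/
theorem stairInfoSym_mem_privateFisherInfos [SigmaFinite lam] {Θ : Set ℝ} {θ₀ : ℝ}
    (hθ₀ : θ₀ ∈ interior Θ) {P : ℝ → Measure 𝒳} (hP : ∀ θ ∈ Θ, IsProbabilityMeasure (P θ))
    (hPdom : ∀ θ ∈ Θ, P θ ≪ lam) {s : 𝒳 → ℝ} (hs : IsDQMScore lam P θ₀ s) (hα : 0 < α)
    (r : StairBox lam α) :
    2 / (Real.exp α + 1) * stairInfoSym s (modelDensity lam (P θ₀)) r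
      ∈ privateFisherInfos α Θ P θ₀ := by
  have hmem : θ₀ ∈ Θ := interior_subset hθ₀
  have := hP θ₀ hmem
  obtain ⟨U, hU, hUb, hsum, hval⟩ := exists_binary_split hα (hPdom θ₀ hmem) s r
  refine ⟨Bool, inferInstance, inferInstance, inferInstance, inferInstance, binaryKernel α U,
    isMarkovKernel_binaryKernel hU hUb hsum, isLDP_binaryKernel hU hUb, ?_⟩
  rw [← hval, ← integral_binaryBase fun b => (∫ x, s x * U b x ∂P θ₀) ^ 2 / ∫ x, U b x ∂P θ₀]
  have hdiff := fun ε (hε : (0 : ℝ) < ε) => hs.eventually_abs_integral_sub_le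
    (eventually_isProbabilityMeasure hθ₀ hP hPdom) (Real.exp α) hε
  have habs : ∀ b x, |U b x| ≤ Real.exp α := fun b x => by
    rw [abs_of_nonneg (zero_le_one.trans (hUb b x).1)]
    exact (hUb b x).2
  refine hasFisherInfo_of_uniformly_differentiable hθ₀ (binaryBase α)
    (f := fun θ b => ∫ x, U b x ∂P θ) (g := fun b => ∫ x, s x * U b x ∂P θ₀)
    Measurable.of_discrete (C := ∑ b, |∫ x, s x * U b x ∂P θ₀|) (fun b => ?_)
    (fun θ _ => Measurable.of_discrete) (fun θ hθ b => ?_) (fun θ hθ => ?_) fun ε hε => ?_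
  · exact Finset.single_le_sum (f := fun b => |∫ x, s x * U b x ∂P θ₀|)
      (fun b _ => abs_nonneg _) (Finset.mem_univ b)
  · have := hP θ hθ
    exact (one_le_integral_and_le (hU b) (.of_forall (hUb b))).1
  · have := hP θ hθ
    exact bind_binaryKernel hU hUb (P θ)
  · filter_upwards [hdiff ε hε] with h hh b
    exact hh (U b) (hU b) (habs b)

theorem integral_mul_stairSwap_of_ac {P₀ : Measure 𝒳} (hP : P₀ ≪ lam) (r : StairBox lam α)
    {f : 𝒳 → ℝ} (hf : Integrable f P₀) :
    ∫ x, f x * (stairSwap r).toFun x ∂P₀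
      = (Real.exp α + 1) * ∫ x, f x ∂P₀ - ∫ x, f x * r.toFun x ∂P₀ := by
  rw [← integral_const_mul, ← integral_sub (hf.const_mul _)
    (hf.mul_bdd (c := Real.exp α) r.measurable_toFun.aestronglyMeasurable (hP.ae_le r.ae_abs_le))]
  refine integral_congr_ae ?_
  filter_upwards [hP.ae_le (stairSwap_ae r)] with x hx
  rw [hx]; ring

/-- An extremal `r` equals `1 + (e^α - 1) 1_F` a.e., with `F` its upper level set. -/
theorem integral_mul_of_mem_stairExtremal {P₀ : Measure 𝒳} [IsFiniteMeasure P₀] [SigmaFinite lam]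
    (hP : P₀ ≪ lam) {r : StairBox lam α} (hr : r ∈ stairExtremal lam α) {f : 𝒳 → ℝ}
    (hf : Integrable f P₀) :
    ∫ x, f x * r.toFun x ∂P₀ = ∫ x, f x ∂P₀
      + (Real.exp α - 1) * ∫ x in stairLevel r, f x * modelDensity lam P₀ x ∂lam := by
  have hm : MeasurableSet (stairLevel r) := r.measurable_toFun (measurableSet_singleton _)
  have h1 : ∫ x in stairLevel r, f x * modelDensity lam P₀ x ∂lam
      = ∫ x, (stairLevel r).indicator f x ∂P₀ := by
    rw [← integral_indicator hm, ← integral_mul_modelDensity hP]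
    simp only [Set.indicator_mul_left]
  rw [h1, ← integral_const_mul, ← integral_add hf ((hf.indicator hm).const_mul _)]
  have hr' : ∀ᵐ x ∂lam, r.toFun x = 1 ∨ r.toFun x = Real.exp α := hr
  refine integral_congr_ae ?_
  filter_upwards [hP.ae_le hr'] with x hx
  by_cases h : x ∈ stairLevel r
  · have h' : r.toFun x = Real.exp α := h
    rw [Set.indicator_of_mem h, h']; ring
  · have h' : r.toFun x = 1 := hx.resolve_right h
    rw [Set.indicator_of_notMem h, h']; ring

/-- As the score is centred, the numerators of `i(r)` and `i(T r)` are both `(e^α - 1)² b²`, where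
`b` is the score integral over the level set. The denominators add up to `e^α + 1`, so their
reciprocals add up to `e^α + 1` over their product. -/
theorem stairInfoSym_of_mem_stairExtremal [SigmaFinite lam] {P₀ : Measure 𝒳}
    [IsProbabilityMeasure P₀] (hP : P₀ ≪ lam) {s : 𝒳 → ℝ} (hs : Integrable s P₀)
    (hs0 : ∫ x, s x ∂P₀ = 0) {r : StairBox lam α} (hr : r ∈ stairExtremal lam α) :
    stairInfoSym s (modelDensity lam P₀) r =
      (Real.exp α - 1) ^ 2 * (Real.exp α + 1) / 2 *
        ((∫ x in stairLevel r, s x * modelDensity lam P₀ x ∂lam) ^ 2 /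
          ((Real.exp α - (Real.exp α - 1) * ∫ x in stairLevel r, modelDensity lam P₀ x ∂lam) *
            (1 + (Real.exp α - 1) * ∫ x in stairLevel r, modelDensity lam P₀ x ∂lam))) := by
  have h1 := integral_mul_of_mem_stairExtremal hP hr (integrable_const (1 : ℝ))
  have h2 := integral_mul_stairSwap_of_ac hP r (integrable_const (1 : ℝ))
  have h3 := integral_mul_of_mem_stairExtremal hP hr hs
  have h4 := integral_mul_stairSwap_of_ac hP r hs
  have b1 := (r.one_le_integral_and_le hP).1
  have b2 := ((stairSwap r).one_le_integral_and_le hP).1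
  simp only [one_mul, integral_const, probReal_univ, smul_eq_mul, mul_one] at h1 h2
  rw [stairInfoSym, stairInfo_eq hP, stairInfo_eq hP, h4, h3, h2, h1, hs0]
  rw [h2, h1] at b2
  rw [h1] at b1
  generalize ∫ x in stairLevel r, modelDensity lam P₀ x ∂lam = a at *
  generalize ∫ x in stairLevel r, s x * modelDensity lam P₀ x ∂lam = b at *
  have e : Real.exp α + 1 - (1 + (Real.exp α - 1) * a) = Real.exp α - (Real.exp α - 1) * a := by
    ring
  rw [e] at b2 ⊢
  have n1 : 1 + (Real.exp α - 1) * a ≠ 0 := by positivity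
  have n2 : Real.exp α - (Real.exp α - 1) * a ≠ 0 := by positivity
  field_simp
  ring

variable {d : ℕ} {X : Set (EuclideanSpace ℝ (Fin d))}

/-- The averages of `T r` are `e^α + 1` minus those of `r`, so the sum is `e^α + 1` plus `limsup -
liminf`. Equality can fail where the averages do not converge, but this inequality holds at every
`x` for every `r`, so the mass bound can be read off at a single `x`. -/
theorem add_one_le_stairEval_add_stairEval_stairSwap (hX : IsOpen X) (x : X)
    (r : StairBox (lebesgueOn X) α) :
    Real.exp α + 1 ≤ stairEval x r + stairEval x (stairSwap r) := by
  have hb := fun n => stairAverage_mem_Icc hX n x r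
  have hle : IsBoundedUnder (· ≤ ·) atTop fun n => stairAverage n x r :=
    isBoundedUnder_of ⟨Real.exp α, fun n => (hb n).2⟩
  have hge : IsBoundedUnder (· ≥ ·) atTop fun n => stairAverage n x r :=
    isBoundedUnder_of ⟨1, fun n => (hb n).1⟩
  rw [stairEval_eq, stairEval_eq]
  simp only [stairAverage_stairSwap hX]
  rw [limsup_const_sub _ _ _ hle.isCoboundedUnder_ge hge]
  linarith [liminf_le_limsup hle hge]

/-- A symmetric normalized measure has mass at most `2 / (e^α + 1)`. -/
theorem measureReal_univ_le_of_symmetric (hX : IsOpen X) [Nonempty X]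
    {μ : Measure (stairExtremal (lebesgueOn X) α)} [IsFiniteMeasure μ] (hμ : IsStairNormalized μ)
    (hsymm : μ.map stairSwapE = μ) : μ.real Set.univ ≤ 2 / (Real.exp α + 1) := by
  have hne : (ae (lebesgueOn X)).NeBot := ae_lebesgueOn_neBot hX
  obtain ⟨x, hx⟩ := hμ.normalized.exists
  have hm : Measurable fun r : stairExtremal (lebesgueOn X) α => stairEval x r.1 :=
    (measurable_stairEval hX x).comp measurable_subtype_coe
  have hi : Integrable (fun r : stairExtremal (lebesgueOn X) α => stairEval x r.1) μ :=
    -- The integral of a nonintegrable function is `0` by convention, so the value `1` forces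
    -- integrability.
    Integrable.of_integral_ne_zero (by rw [hx]; exact one_ne_zero)
  have hi' : Integrable (fun r : stairExtremal (lebesgueOn X) α => stairEval x (stairSwap r.1)) μ :=
    Integrable.comp_measurable (f := stairSwapE) (by rwa [hsymm]) measurable_stairSwapE
  have hx' : ∫ r : stairExtremal (lebesgueOn X) α, stairEval x (stairSwap r.1) ∂μ = 1 := by
    rw [← hx]
    conv_rhs => rw [← hsymm]
    rw [integral_map measurable_stairSwapE.aemeasurable hm.aestronglyMeasurable]
    rfl
  rw [le_div_iff₀ (by positivity)]
  calc μ.real Set.univ * (Real.exp α + 1)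
      = ∫ _, (Real.exp α + 1) ∂μ := by rw [integral_const, smul_eq_mul]
    _ ≤ ∫ r : stairExtremal (lebesgueOn X) α,
          (stairEval x r.1 + stairEval x (stairSwap r.1)) ∂μ :=
        integral_mono (integrable_const _) (hi.add hi') fun r =>
          add_one_le_stairEval_add_stairEval_stairSwap hX x r.1
    _ = 2 := by rw [integral_add hi hi', hx, hx']; norm_num

/-- The Fisher information of the model privatized by a staircase mechanism. -/
theorem hasFisherInfo_stairPublicLaw (hX : IsOpen X) {Θ : Set ℝ} {θ₀ : ℝ}
    (hθ₀ : θ₀ ∈ interior Θ) {P : ℝ → Measure X} (hP : ∀ θ ∈ Θ, IsProbabilityMeasure (P θ))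
    (hPdom : ∀ θ ∈ Θ, P θ ≪ lebesgueOn X) {s : X → ℝ} (hs : IsDQMScore (lebesgueOn X) P θ₀ s)
    (hα : 0 < α) (μ : Measure (stairExtremal (lebesgueOn X) α)) [IsFiniteMeasure μ] :
    HasFisherInfo Θ (fun θ => stairPublicLaw μ (P θ)) θ₀
      (∫ r, stairInfo s (modelDensity (lebesgueOn X) (P θ₀)) r.1 ∂μ) := by
  have := sigmaFinite_lebesgueOn hX
  have hmem : θ₀ ∈ Θ := interior_subset hθ₀
  have := hP θ₀ hmem
  have hev := eventually_isProbabilityMeasure hθ₀ hP hPdom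
  have hsi := hs.integrable hev
  simp only [stairInfo_eq (hPdom θ₀ hmem)]
  refine hasFisherInfo_of_uniformly_differentiable hθ₀ μ
    (f := fun θ r => ∫ x, r.1.toFun x ∂P θ) (g := fun r => ∫ x, s x * r.1.toFun x ∂P θ₀)
    ((continuous_integral_mul_stairBox (hPdom θ₀ hmem) hsi).measurable.comp measurable_subtype_coe)
    (C := Real.exp α * ∫ x, |s x| ∂P θ₀)
    (fun r => abs_integral_mul_stairBox_le (hPdom θ₀ hmem) hsi r.1)
    (fun θ hθ => ?_) (fun θ hθ r => ?_) (fun θ hθ => ?_) fun ε hε => ?_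
  · have := hP θ hθ
    exact (continuous_integral_stairBox (hPdom θ hθ)).measurable.comp measurable_subtype_coe
  · have := hP θ hθ
    exact (r.1.one_le_integral_and_le (hPdom θ hθ)).1
  · have := hP θ hθ
    -- For fixed `r`, `e_x(r) = r(x)` for a.e. `x`, so the public law has density `r ↦ ∫ r dP_θ`.
    rw [stairPublicLaw]
    congr 1
    funext r
    have hint : Integrable (fun x => r.1.toFun x) (P θ) :=
      Integrable.of_integral_ne_zero
        (zero_lt_one.trans_le (r.1.one_le_integral_and_le (hPdom θ hθ)).1).ne'
    rw [ofReal_integral_eq_lintegral_ofReal hint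
      ((hPdom θ hθ).ae_le (r.1.bounds.mono fun x hx => zero_le_one.trans hx.1))]
    refine lintegral_congr_ae ?_
    filter_upwards [(hPdom θ hθ).ae_le (stairEval_ae hX r.1)] with x hx
    rw [hx]
  · filter_upwards [hs.eventually_abs_integral_sub_le hev (Real.exp α) hε, eventually_shift hev]
      with h hh hdom r
    -- The range of admissible `h` was fixed before `r`: the derivative estimate depends on the test
    -- function only through the bound `e^α`.
    obtain ⟨u, hu, hub, hru⟩ := r.1.exists_representative hα
    have h1 : ∫ x, r.1.toFun x ∂P (θ₀ + h) = ∫ x, u x ∂P (θ₀ + h) :=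
      integral_congr_ae (hdom.2.ae_eq hru)
    have h2 : ∫ x, r.1.toFun x ∂P θ₀ = ∫ x, u x ∂P θ₀ :=
      integral_congr_ae ((hPdom θ₀ hmem).ae_eq hru)
    have h3 : ∫ x, s x * r.1.toFun x ∂P θ₀ = ∫ x, s x * u x ∂P θ₀ := by
      refine integral_congr_ae ?_
      filter_upwards [(hPdom θ₀ hmem).ae_eq hru] with x hx
      rw [hx]
    rw [h1, h2, h3]
    refine hh u hu fun x => ?_
    rw [abs_of_nonneg (zero_le_one.trans (hub x).1)]
    exact (hub x).2

end Main

theorem theorem1 {d : ℕ} (X : Set (EuclideanSpace ℝ (Fin d))) (hX : IsOpen X)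
    (Θ : Set ℝ) (θ₀ : ℝ) (hθ₀ : θ₀ ∈ interior Θ)
    (P : ℝ → Measure X) (hP : ∀ θ ∈ Θ, IsProbabilityMeasure (P θ))
    (hPdom : ∀ θ ∈ Θ, P θ ≪ lebesgueOn X)
    (p : X → ℝ) (hp : p = modelDensity (lebesgueOn X) (P θ₀))
    (s : X → ℝ) (hs : IsDQMScore (lebesgueOn X) P θ₀ s)
    (α : ℝ) (hα : 0 < α)
    (μ : Measure (stairExtremal (lebesgueOn X) α)) (hμ : IsStairMaximizer s p μ)
    (hsymm : μ.map stairSwapE = μ) :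
    (∃ c : ℝ, ∀ᵐ r ∂μ, stairInfoSym s p r.1 = c) ∧
    (∃ m : ℝ,
      IsGreatest (Set.range (fun r : StairBox (lebesgueOn X) α => stairInfoSym s p r)) m ∧
      IsGreatest (privateFisherInfos α Θ P θ₀) (2 / (Real.exp α + 1) * m) ∧
      IsGreatest (stairObjectives (lebesgueOn X) α s p) (2 / (Real.exp α + 1) * m) ∧
      HasFisherInfo Θ (fun θ => stairPublicLaw μ (P θ)) θ₀ (2 / (Real.exp α + 1) * m)) ∧
    (∀ r ∈ stairExtremal (lebesgueOn X) α,
      stairInfoSym s p r =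
        (Real.exp α - 1) ^ 2 * (Real.exp α + 1) / 2 *
          ((∫ x in stairLevel r, s x * p x ∂(lebesgueOn X)) ^ 2 /
            ((Real.exp α - (Real.exp α - 1) * ∫ x in stairLevel r, p x ∂(lebesgueOn X)) *
              (1 + (Real.exp α - 1) * ∫ x in stairLevel r, p x ∂(lebesgueOn X))))) := by
  subst hp
  have := sigmaFinite_lebesgueOn hX
  have hmem : θ₀ ∈ Θ := interior_subset hθ₀
  have hP₀ := hP θ₀ hmem
  have hne : Nonempty X := nonempty_of_isProbabilityMeasure (P θ₀)
  have hdom := hPdom θ₀ hmem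
  have hev := eventually_isProbabilityMeasure hθ₀ hP hPdom
  have hsi := hs.integrable hev
  have hfin : IsFiniteMeasure μ := ⟨hμ.1.subprob.trans_lt ENNReal.one_lt_top⟩
  set p := modelDensity (lebesgueOn X) (P θ₀) with hp
  set J := ∫ r, stairInfo s p r.1 ∂μ with hJ
  have hexp : 0 < Real.exp α + 1 := by positivity
  have hJ0 : 0 ≤ J := integral_nonneg fun r => stairInfo_nonneg hdom s r.1
  have hle : ∀ r : StairBox (lebesgueOn X) α, 2 / (Real.exp α + 1) * stairInfoSym s p r ≤ J := by
    intro r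
    obtain ⟨U, hU, hUb, hsum, hval⟩ := exists_binary_split hα hdom s r
    rw [← hval]
    exact sum_info_le hX hα hdom hsi hμ.2 hU hUb (fun _ => by positivity) hsum
  have hcJ : 2 / (Real.exp α + 1) * ((Real.exp α + 1) / 2 * J) = J := by field_simp
  have hle' : ∀ r : StairBox (lebesgueOn X) α,
      stairInfoSym s p r ≤ (Real.exp α + 1) / 2 * J := fun r => by
    refine le_of_mul_le_mul_left ?_ (by positivity : 0 < 2 / (Real.exp α + 1))
    rw [hcJ]
    exact hle r
  have hi := integrable_stairInfo hdom hsi μ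
  have hi' : Integrable (fun r : stairExtremal (lebesgueOn X) α =>
      stairInfo s p (stairSwap r.1)) μ :=
    Integrable.comp_measurable (f := stairSwapE) (by rwa [hsymm]) measurable_stairSwapE
  have hswap : ∫ r : stairExtremal (lebesgueOn X) α, stairInfo s p (stairSwap r.1) ∂μ = J := by
    rw [hJ]
    conv_rhs => rw [← hsymm]
    rw [integral_map measurable_stairSwapE.aemeasurable (by rw [hsymm]; exact hi.1)]
    rfl
  have hiS : Integrable (fun r : stairExtremal (lebesgueOn X) α => stairInfoSym s p r.1) μ :=
    (hi.add hi').const_mul _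
  have hsymInt : ∫ r : stairExtremal (lebesgueOn X) α, stairInfoSym s p r.1 ∂μ = J := by
    simp only [stairInfoSym]
    rw [integral_const_mul, integral_add hi hi', hswap, ← hJ]
    ring
  -- The mass bound makes the integral of the nonnegative gap at most `J - J = 0`.
  have hconst : ∀ᵐ r ∂μ, stairInfoSym s p r.1 = (Real.exp α + 1) / 2 * J := by
    have hnn : ∀ r : stairExtremal (lebesgueOn X) α,
        0 ≤ (Real.exp α + 1) / 2 * J - stairInfoSym s p r.1 := fun r => sub_nonneg.2 (hle' r.1)
    have hint : ∫ r : stairExtremal (lebesgueOn X) α,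
        ((Real.exp α + 1) / 2 * J - stairInfoSym s p r.1) ∂μ = 0 := by
      refine le_antisymm ?_ (integral_nonneg hnn)
      rw [integral_sub (integrable_const _) hiS, hsymInt, integral_const, smul_eq_mul, sub_nonpos]
      calc _ ≤ 2 / (Real.exp α + 1) * ((Real.exp α + 1) / 2 * J) :=
            mul_le_mul_of_nonneg_right (measureReal_univ_le_of_symmetric hX hμ.1 hsymm)
              (by positivity)
        _ = J := hcJ
    filter_upwards [(integral_eq_zero_iff_of_nonneg hnn ((integrable_const _).sub hiS)).1 hint]
      with r hr
    simp only [Pi.zero_apply] at hr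
    linarith
  -- The zero measure is not normalized, so the a.e. equality holds at some `r₀`, which is a
  -- maximizer.
  have hμ0 : (ae μ).NeBot := by
    rw [ae_neBot]
    rintro rfl
    have hne' : (ae (lebesgueOn X)).NeBot := ae_lebesgueOn_neBot hX
    obtain ⟨x, hx⟩ := hμ.1.normalized.exists
    simp at hx
  obtain ⟨r₀, hr₀⟩ := hconst.exists
  refine ⟨⟨_, hconst⟩, ⟨(Real.exp α + 1) / 2 * J, ⟨⟨r₀.1, hr₀⟩, ?_⟩, ⟨?_, ?_⟩, ⟨?_, ?_⟩, ?_⟩, ?_⟩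
  · rintro _ ⟨r, rfl⟩
    exact hle' r
  -- The maximum is attained by the binary mechanism of `r₀`, a Markov kernel at every `x`; the
  -- staircase mechanism is normalized only for a.e. `x`.
  · rw [← hr₀]
    exact stairInfoSym_mem_privateFisherInfos hθ₀ hP hPdom hs hα r₀.1
  · rintro I ⟨Z, _, _, _, _, Q, _, hQ, ν, hν, hac, t, ht, rfl⟩
    rw [hcJ]
    refine fisherInfo_bind_le hX hα hs hev hμ.2 hQ ht ?_
    filter_upwards [mem_interior_iff_mem_nhds.1 hθ₀] with θ hθ using hac θ hθ
  · rw [hcJ]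
    exact ⟨μ, hμ.1, hJ⟩
  · rintro _ ⟨μ', hμ', rfl⟩
    rw [hcJ]
    exact hμ.2 μ' hμ'
  · rw [hcJ]
    exact hasFisherInfo_stairPublicLaw hX hθ₀ hP hPdom hs hα μ
  · intro r hr
    exact stairInfoSym_of_mem_stairExtremal hdom hsi (hs.integral_eq_zero hev) hr
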